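/- Let $k$ be an algebraically closed field of characteristic zero, let $T=\mathbb{G}_m^2$ be the torus over $k$ with coordinate ring $k[x^{\pm1},y^{\pm1}]$, and let $e=(1,1)\in T$. We say that $f\in k[x^{\pm1},y^{\pm1}]$ defines a negative curve vanishing to order $m$ at $e$ if $f$ is irreducible, vanishes at $e$ to order exactly $m$, and its Newton polygon lies in some nondegenerate triangle of area at most $m^2/2$. Two curves in $T$ are isomorphic if some automorphism of the variety $T$ carries one to the other. Let $M,N\ge 0$ and $K\ge 3$ be integers with $(M+N)^2=KMN+1$. Let $IT(M,N)$ be the (possibly degenerate) triangle with vertices $(0,0)$, $(M+N,KN)$, $(M,0)$, and let $RT(M,N)$ be the triangle with vertices $(0,0)$, $(M,M+N)$, $\left(M-\frac{M+N}{K},0\right)$. 1. The triangle $IT(M,N)$ has area at most $(M+N)^2/2$ and contains the Newton polygon of a polynomial defining a negative curve that vanishes to order $M+N$ at $e$. If $M>0$, the triangle $RT(M,N)$ has area at most $M^2/2$ and contains the Newton polygon of a polynomial defining a negative curve that vanishes to order $M$ at $e$. 2. Consider the triangles $IT(M,N)$ for all solutions with $M\ge N>0$ and $RT(M,N)$ for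 all solutions with $M>N>1$ (here $K\geq 3$ varies; it is determined by $M$ and $N$). The negative curves of part 1 (of order $M+N$ in $IT(M,N)$, respectively of order $M$ in $RT(M,N)$) belonging to two different triangles of this list are never isomorphic. -/

import Mathlib

namespace NegativeCurves

noncomputable section

/-- The ring `k[x^{±1}, y^{±1}]`, the coordinate ring of the torus `T = 𝔾ₘ²` over `k`;
the lattice point `(a, b)` stands for the monomial `x^a y^b`. -/
abbrev LaurentRing (k : Type*) [Field k] : Type _ := AddMonoidAlgebra k (ℤ × ℤ)

/-- The ideal `(x - 1, y - 1)` of the point `e = (1, 1)` of the torus. -/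
def idealE (k : Type*) [Field k] : Ideal (LaurentRing k) :=
  Ideal.span {AddMonoidAlgebra.single (1, 0) 1 - 1, AddMonoidAlgebra.single (0, 1) 1 - 1}

/-- `f` vanishes at `e = (1, 1)` to order exactly `m`. -/
def VanishesToOrder {k : Type*} [Field k] (f : LaurentRing k) (m : ℕ) : Prop :=
  f ∈ idealE k ^ m ∧ f ∉ idealE k ^ (m + 1)

/-- The Newton polygon: the convex hull in `ℝ²` of the exponents of the monomials of `f`. -/
def newtonPolygon {k : Type*} [Field k] (f : LaurentRing k) : Set (ℝ × ℝ) :=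
  convexHull ℝ ((fun u : ℤ × ℤ => ((u.1 : ℝ), (u.2 : ℝ))) '' (f.coeff.support : Set (ℤ × ℤ)))

/-- A possibly degenerate triangle in the plane, given by its three vertices. -/
structure PlaneTriangle where
  p : ℝ × ℝ
  q : ℝ × ℝ
  r : ℝ × ℝ

/-- The closed region bounded by the triangle. -/
def PlaneTriangle.region (D : PlaneTriangle) : Set (ℝ × ℝ) :=
  convexHull ℝ {D.p, D.q, D.r}

/-- The area of the triangle. -/
def PlaneTriangle.area (D : PlaneTriangle) : ℝ :=
  |(D.q.1 - D.p.1) * (D.r.2 - D.p.2) - (D.r.1 - D.p.1) * (D.q.2 - D.p.2)| / 2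

/-- `f` defines a negative curve in the torus with vanishing order `m` at `e`: it is irreducible,
vanishes to order `m` at `e`, and its Newton polygon fits into some (nondegenerate) triangle of
area at most `m² / 2`. -/
def DefinesNegativeCurve {k : Type*} [Field k] (f : LaurentRing k) (m : ℕ) : Prop :=
  Irreducible f ∧ VanishesToOrder f m ∧
    ∃ D : PlaneTriangle, 0 < D.area ∧ D.area ≤ (m : ℝ) ^ 2 / 2 ∧ newtonPolygon f ⊆ D.region

/-- The triangle `D`, of area at most `m² / 2`, supports the polynomial `f`, and `f` defines a
negative curve that vanishes to order `m` at `e`. -/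
def SupportsNegativeCurve {k : Type*} [Field k] (D : PlaneTriangle) (m : ℕ)
    (f : LaurentRing k) : Prop :=
  D.area ≤ (m : ℝ) ^ 2 / 2 ∧ newtonPolygon f ⊆ D.region ∧ DefinesNegativeCurve f m

/-- Some automorphism of the torus (as a variety over `k`, that is, a `k`-algebra automorphism of
its coordinate ring) carries the curve `f = 0` to the curve `g = 0`. -/
def IsomorphicCurves {k : Type*} [Field k] (f g : LaurentRing k) : Prop :=
  ∃ σ : LaurentRing k ≃ₐ[k] LaurentRing k,
    Ideal.map (σ : LaurentRing k →+* LaurentRing k) (Ideal.span {f}) = Ideal.span {g}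

/-- The triples `M, N ≥ 0`, `K ≥ 3` with `(M + N)² = K M N + 1`. -/
def IsSolution (M N K : ℕ) : Prop :=
  3 ≤ K ∧ (M + N) ^ 2 = K * M * N + 1

/-- The integral triangle. -/
def IT (M N K : ℕ) : PlaneTriangle where
  p := (0, 0)
  q := ((M : ℝ) + N, (K : ℝ) * N)
  r := ((M : ℝ), 0)

/-- The rational triangle. -/
def RT (M N K : ℕ) : PlaneTriangle where
  p := (0, 0)
  q := ((M : ℝ), (M : ℝ) + N)
  r := ((M : ℝ) - ((M : ℝ) + N) / K, 0)

end

end NegativeCurves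

namespace NegativeCurves

open AddMonoidAlgebra

variable {k : Type*} [Field k]

/-! ### Supports of products, units, and irreducibility from a primitive edge -/

section Supports

/-! Outside the degenerate case M N = 0, both families are instances of one triangle, with vertices
(0,0), (m,n), (m - n/K, 0) and twice the area m² - δ/K, where 0 < δ ≤ K (`IsAdmissible`): δ = K for
the integral triangles and δ = 1 for the rational ones. The lower sides have integral slopes 0 and
K, and the area is so close to m²/2 that the columns x = 0, ..., m contain 1, 1, 2, ..., m lattice
points in some order (`IsAdmissible.exists_columns`). This is one point more than the m(m+1)/2
linear conditions for order m at e, so some nonzero f vanishes to order m.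

Vanishing to order m makes the coefficients of f orthogonal to all polynomials of degree less than m
in the exponents (`moment_eq_zero`). If f missed an extreme column, products of linear forms would
isolate its coefficients, smallest columns first, and f would be zero (`eq_zero_of_missing_column`).
Hence (0,0) and (m,n) both occur in f. The segment joining them is a primitive edge spanning the
full width, which forces irreducibility, and the lone monomial in column 0 keeps the order from
exceeding m.

For non-isomorphism, torus automorphisms act on exponents by unimodular maps, because units are
monomials, and generators of an ideal differ by a further translation. An irreducible f of order m ≥
2 has lattice width at least m in every direction (`exists_width_ge`), and exactly m horizontally in
these triangles. So an isomorphism preserves m and pulls the first coordinate back to a direction of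
width m; only ±x, ±(y - x), ±(y - 2x) survive (`IsLatticeIso.cases`). With n = m + r, comparing a
map with its inverse and using the scarcity of steep slopes yields r' = r or r' = m - r
(`IsLatticeIso.slope_eq`). Congruences modulo m drawn from (M+N)² = KMN + 1 then finish, except for
an integral triangle with r = 1 against a rational one with r' = m - 1. These are separated by the
depth of a lattice point below the long edge. -/

/-- The monomials of `g` and `h` that are extremal for a lexicographic order multiply to a monomial
of `g * h`. -/
theorem exists_lex_extremal (a b c d : ℤ) (hdet : a * d - b * c ≠ 0) {g h : LaurentRing k}
    (hg : g ≠ 0) (hh : h ≠ 0) :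
    ∃ u ∈ g.coeff.support, ∃ v ∈ h.coeff.support, u + v ∈ (g * h).coeff.support ∧
      (∀ u' ∈ g.coeff.support, a * u'.1 + b * u'.2 < a * u.1 + b * u.2 ∨
        (a * u'.1 + b * u'.2 = a * u.1 + b * u.2 ∧ c * u'.1 + d * u'.2 ≤ c * u.1 + d * u.2)) ∧
      (∀ v' ∈ h.coeff.support, a * v'.1 + b * v'.2 < a * v.1 + b * v.2 ∨
        (a * v'.1 + b * v'.2 = a * v.1 + b * v.2 ∧ c * v'.1 + d * v'.2 ≤ c * v.1 + d * v.2)) := by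
  set ω : ℤ × ℤ → ℤ ×ₗ ℤ := fun u => toLex (a * u.1 + b * u.2, c * u.1 + d * u.2) with hω
  have hadd : ∀ u v, ω (u + v) = ω u + ω v := by
    intro u v
    simp only [hω, ← toLex_add, Prod.mk_add_mk, Prod.fst_add, Prod.snd_add]
    congr 2 <;> ring
  have hinj : Function.Injective ω := by
    intro u v huv
    have h1 : (a * u.1 + b * u.2, c * u.1 + d * u.2) = (a * v.1 + b * v.2, c * v.1 + d * v.2) :=
      toLex.injective huv
    obtain ⟨e1, e2⟩ := Prod.mk.inj h1
    ext
    · apply mul_left_cancel₀ hdet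
      linear_combination d * e1 - b * e2
    · apply mul_left_cancel₀ hdet
      linear_combination a * e2 - c * e1
  have hle : ∀ u v, ω u ≤ ω v → a * u.1 + b * u.2 < a * v.1 + b * v.2 ∨
      (a * u.1 + b * u.2 = a * v.1 + b * v.2 ∧ c * u.1 + d * u.2 ≤ c * v.1 + d * v.2) := by
    intro u v huv
    simpa [hω, Prod.Lex.toLex_le_toLex] using huv
  have hg' : g.coeff.support.Nonempty := by simpa [Finsupp.support_nonempty_iff] using hg
  have hh' : h.coeff.support.Nonempty := by simpa [Finsupp.support_nonempty_iff] using hh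
  obtain ⟨u, hu, humax⟩ := g.coeff.support.exists_max_image ω hg'
  obtain ⟨v, hv, hvmax⟩ := h.coeff.support.exists_max_image ω hh'
  have huniq : UniqueAdd g.coeff.support h.coeff.support u v := by
    intro u' v' hu' hv' he
    have h1 := humax u' hu'
    have h2 := hvmax v' hv'
    have h3 : ω u' + ω v' = ω u + ω v := by rw [← hadd, ← hadd, he]
    have h4 : ω u' = ω u := by
      refine le_antisymm h1 (le_of_not_gt fun hlt => ?_)
      exact absurd h3 (add_lt_add_of_lt_of_le hlt h2).ne
    have h5 : u' = u := hinj h4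
    subst h5
    exact ⟨rfl, add_left_cancel he⟩
  refine ⟨u, hu, v, hv, ?_, fun u' hu' => hle _ _ (humax u' hu'),
    fun v' hv' => hle _ _ (hvmax v' hv')⟩
  rw [Finsupp.mem_support_iff, coeff_mul_add_of_uniqueAdd huniq]
  exact mul_ne_zero (Finsupp.mem_support_iff.1 hu) (Finsupp.mem_support_iff.1 hv)

theorem exists_add_of_mem_support_mul {g h : LaurentRing k} {w : ℤ × ℤ}
    (hw : w ∈ (g * h).coeff.support) :
    ∃ u ∈ g.coeff.support, ∃ v ∈ h.coeff.support, u + v = w := by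
  classical
  have := support_coeff_mul_subset g h hw
  exact Finset.mem_add.1 this

theorem eq_single_of_support_subset {g : LaurentRing k} {u : ℤ × ℤ}
    (h : ∀ v ∈ g.coeff.support, v = u) : g = single u (g.coeff u) := by
  classical
  ext v
  rw [coeff_single, Finsupp.single_apply]
  split_ifs with hv
  · rw [hv]
  · by_contra hne
    exact hv (h v (Finsupp.mem_support_iff.2 hne)).symm

theorem isUnit_single {u : ℤ × ℤ} {c : k} (hc : c ≠ 0) :
    IsUnit (single u c : LaurentRing k) := by
  refine IsUnit.of_mul_eq_one (single (-u) c⁻¹) ?_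
  rw [single_mul_single, add_neg_cancel, mul_inv_cancel₀ hc, one_def]

/-- The units of the Laurent polynomial ring are the monomials. -/
theorem exists_eq_single_of_isUnit {g : LaurentRing k} (hg : IsUnit g) :
    ∃ (u : ℤ × ℤ) (c : k), c ≠ 0 ∧ g = single u c := by
  obtain ⟨h, hgh⟩ := hg.exists_right_inv
  have hg0 : g ≠ 0 := hg.ne_zero
  have hh0 : h ≠ 0 := by rintro rfl; simp at hgh
  have hone : ∀ w ∈ (g * h).coeff.support, w = 0 := by
    intro w hw
    rw [hgh, one_def, coeff_single] at hw
    simpa using Finsupp.support_single_subset hw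
  -- The lexicographically largest monomials of `g` and `h` multiply to 1, and so do the smallest;
  -- hence largest and smallest agree in each factor.
  obtain ⟨u, hu, v, -, huv, humax, hvmax⟩ := exists_lex_extremal 1 0 0 1 (by norm_num) hg0 hh0
  obtain ⟨u', hu', v', hv', huv', humax', hvmax'⟩ :=
    exists_lex_extremal (-1) 0 0 (-1) (by norm_num) hg0 hh0
  have e := hone _ huv
  have e' := hone _ huv'
  simp only [Prod.ext_iff, Prod.fst_add, Prod.snd_add, Prod.fst_zero, Prod.snd_zero] at e e'
  refine ⟨u, g.coeff u, Finsupp.mem_support_iff.1 hu, eq_single_of_support_subset ?_⟩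
  intro w hw
  have h1 := humax w hw
  have h2 := humax' w hw
  have h3 := hvmax v' hv'
  have h4 := humax u' hu'
  ext <;> omega

/-- A Laurent polynomial whose Newton polygon lies strictly below a primitive edge joining its
two extreme vertical columns is irreducible. -/
theorem irreducible_of_primitive_edge {f : LaurentRing k} {m : ℕ} {n : ℤ} (hm : 0 < m)
    (hcop : IsCoprime (m : ℤ) n) (h0 : (0, 0) ∈ f.coeff.support)
    (h1 : ((m : ℤ), n) ∈ f.coeff.support)
    (hx : ∀ u ∈ f.coeff.support, 0 ≤ u.1 ∧ u.1 ≤ m ∧ m * u.2 ≤ n * u.1 ∧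
      (u.1 = 0 → u.2 = 0)) : Irreducible f := by
  have hf0 : f ≠ 0 := by rintro rfl; simp at h0
  have hm0 : (0 : ℤ) < m := by exact_mod_cast hm
  have hline : ∀ u : ℤ × ℤ, (m : ℤ) * u.2 = n * u.1 → ∃ d : ℤ, u.1 = d * m ∧ u.2 = d * n := by
    intro u hu
    obtain ⟨d, hd⟩ := hcop.dvd_of_dvd_mul_left (⟨u.2, hu.symm⟩ : (m : ℤ) ∣ n * u.1)
    refine ⟨d, by rw [hd]; ring, ?_⟩
    apply mul_left_cancel₀ hm0.ne'
    rw [hu, hd]; ring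
  have hend : ∀ u ∈ f.coeff.support, (m : ℤ) * u.2 = n * u.1 → u = (0, 0) ∨ u = ((m : ℤ), n) := by
    intro u hu he
    obtain ⟨d, hd1, hd2⟩ := hline u he
    obtain ⟨hx0, hxm, -, -⟩ := hx u hu
    have hd0 : 0 ≤ d := by
      by_contra hneg
      nlinarith
    have hd1' : d ≤ 1 := by
      by_contra hneg
      nlinarith
    have : d = 0 ∨ d = 1 := by omega
    rcases this with rfl | rfl
    · left; ext <;> simp [hd1, hd2]
    · right; ext <;> simp [hd1, hd2]
  refine ⟨fun hu => ?_, ?_⟩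
  · obtain ⟨u, c, hc, rfl⟩ := exists_eq_single_of_isUnit hu
    rw [coeff_single] at h0 h1
    have e0 := Finset.mem_singleton.1 (Finsupp.support_single_subset h0)
    have e1 := Finset.mem_singleton.1 (Finsupp.support_single_subset h1)
    have := congrArg Prod.fst (e0.trans e1.symm)
    simp only at this
    omega
  -- The edge of a product is the sum of the edges of its factors. Primitivity gives the whole edge
  -- to one factor, which then spans all m + 1 columns; `H` shows that the other factor is a unit.
  · suffices H : ∀ g h : LaurentRing k, f = g * h → ∀ u₁ ∈ g.coeff.support,
        ∀ u₂ ∈ g.coeff.support, u₁.1 = u₂.1 + m → IsUnit h by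
      intro g h hgh
      have hg0 : g ≠ 0 := by rintro rfl; simp at hgh; exact hf0 hgh
      have hh0 : h ≠ 0 := by rintro rfl; simp at hgh; exact hf0 hgh
      -- The functional m y - n x is maximal along the edge; ties are broken by x, giving its right
      -- end, and then by -x, giving its left end.
      obtain ⟨u₁, hu₁, v₁, hv₁, huv₁, hu₁max, hv₁max⟩ :=
        exists_lex_extremal (-n) m 1 0 (by simpa using hm0.ne') hg0 hh0
      obtain ⟨u₂, hu₂, v₂, hv₂, huv₂, hu₂max, hv₂max⟩ :=
        exists_lex_extremal (-n) m (-1) 0 (by simpa using hm0.ne') hg0 hh0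
      rw [← hgh] at huv₁ huv₂
      rw [hgh] at h0 h1
      obtain ⟨s, hs, t, ht, hst⟩ := exists_add_of_mem_support_mul h0
      obtain ⟨s', hs', t', ht', hst'⟩ := exists_add_of_mem_support_mul h1
      simp only [Prod.ext_iff, Prod.fst_add, Prod.snd_add] at hst hst'
      have a1 := hu₁max u₂ hu₂
      have a2 := hu₂max u₁ hu₁
      have b1 := hv₁max v₂ hv₂
      have b2 := hv₂max v₁ hv₁
      have c1 := hu₁max s' hs'
      have c2 := hv₁max t' ht'
      have d1 := hu₂max s hs
      have d2 := hv₂max t ht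
      have E1 := hx _ huv₁
      have E2 := hx _ huv₂
      have F1 := hend _ huv₁
      have F2 := hend _ huv₂
      simp only [Prod.ext_iff, Prod.fst_add, Prod.snd_add, mul_add] at E1 E2 F1 F2
      have g1 : (m : ℤ) * s'.2 + m * t'.2 = n * s'.1 + n * t'.1 := by
        linear_combination (m : ℤ) * hst'.2 - n * hst'.1
      have g2 : (m : ℤ) * s.2 + m * t.2 = n * s.1 + n * t.1 := by
        linear_combination (m : ℤ) * hst.2 - n * hst.1
      have hsum1 : u₁.1 + v₁.1 = m := by
        have c1' := c1.elim (fun h => h.le) (fun h => h.1.le)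
        have c2' := c2.elim (fun h => h.le) (fun h => h.1.le)
        have := F1 (by linarith [E1.2.2.1])
        rcases this with h | h
        · exfalso
          obtain ⟨e1, e2⟩ := h
          have e3 : (m : ℤ) * u₁.2 + m * v₁.2 = 0 := by rw [← mul_add, e2, mul_zero]
          have e4 : n * u₁.1 + n * v₁.1 = 0 := by rw [← mul_add, e1, mul_zero]
          rcases c1 with c1 | c1 <;> rcases c2 with c2 | c2 <;> linarith [hst'.1]
        · exact h.1
      have hsum2 : u₂.1 + v₂.1 = 0 := by
        have d1' := d1.elim (fun h => h.le) (fun h => h.1.le)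
        have d2' := d2.elim (fun h => h.le) (fun h => h.1.le)
        have := F2 (by linarith [E2.2.2.1])
        rcases this with h | h
        · exact h.1
        · exfalso
          obtain ⟨e1, e2⟩ := h
          have e3 : (m : ℤ) * u₂.2 + m * v₂.2 = m * n := by rw [← mul_add, e2]
          have e4 : n * u₂.1 + n * v₂.1 = n * m := by rw [← mul_add, e1]
          rcases d1 with d1 | d1 <;> rcases d2 with d2 | d2 <;> linarith [hst.1]
      have hu : (m : ℤ) * (u₁ - u₂).2 = n * (u₁ - u₂).1 := by
        simp only [Prod.fst_sub, Prod.snd_sub]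
        rcases a1 with a1 | a1 <;> rcases a2 with a2 | a2 <;> linarith
      have hv : (m : ℤ) * (v₁ - v₂).2 = n * (v₁ - v₂).1 := by
        simp only [Prod.fst_sub, Prod.snd_sub]
        rcases b1 with b1 | b1 <;> rcases b2 with b2 | b2 <;> linarith
      obtain ⟨d, hd, -⟩ := hline _ hu
      obtain ⟨d', hd', -⟩ := hline _ hv
      simp only [Prod.fst_sub] at hd hd'
      have hd0 : 0 ≤ d * m := by
        rcases a1 with a1 | a1 <;> rcases a2 with a2 | a2 <;> linarith
      have hd'0 : 0 ≤ d' * m := by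
        rcases b1 with b1 | b1 <;> rcases b2 with b2 | b2 <;> linarith
      have hd1 : 0 ≤ d := nonneg_of_mul_nonneg_left hd0 hm0
      have hd'1 : 0 ≤ d' := nonneg_of_mul_nonneg_left hd'0 hm0
      have hdd : (d + d') * m = 1 * m := by linarith
      have hdd' : d + d' = 1 := mul_right_cancel₀ hm0.ne' hdd
      have : d = 1 ∨ d' = 1 := by omega
      rcases this with rfl | rfl
      · right
        exact H g h hgh u₁ hu₁ u₂ hu₂ (by linarith)
      · left
        exact H h g (by rw [hgh, mul_comm]) v₁ hv₁ v₂ hv₂ (by linarith)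
    intro g h hgh u₁ hu₁ u₂ hu₂ hu
    have hg0 : g ≠ 0 := by rintro rfl; simp at hgh; exact hf0 hgh
    have hh0 : h ≠ 0 := by rintro rfl; simp at hgh; exact hf0 hgh
    -- The orders pick the top and the bottom of the leftmost column, then the rightmost column. As
    -- `g` already has width m, `h` lies in one column; as column 0 of `f` is a single point, that
    -- column of `h` is too.
    obtain ⟨u₃, hu₃, v₃, hv₃, huv₃, hu₃max, hv₃max⟩ :=
      exists_lex_extremal (-1) 0 0 1 (by norm_num) hg0 hh0
    obtain ⟨u₄, hu₄, v₄, hv₄, huv₄, hu₄max, hv₄max⟩ :=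
      exists_lex_extremal (-1) 0 0 (-1) (by norm_num) hg0 hh0
    obtain ⟨u₅, hu₅, v₅, hv₅, huv₅, hu₅max, hv₅max⟩ :=
      exists_lex_extremal 1 0 0 1 (by norm_num) hg0 hh0
    rw [← hgh] at huv₃ huv₄ huv₅
    rw [hgh] at h0
    obtain ⟨s, hs, t, ht, hst⟩ := exists_add_of_mem_support_mul h0
    simp only [Prod.ext_iff, Prod.fst_add, Prod.snd_add] at hst
    have E3 := hx _ huv₃
    have E4 := hx _ huv₄
    have E5 := hx _ huv₅
    simp only [Prod.fst_add, Prod.snd_add] at E3 E4 E5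
    have hsingle : ∀ v ∈ h.coeff.support, v = v₃ := by
      intro v hv
      have a1 := hu₃max s hs
      have a2 := hv₃max t ht
      have a3 := hu₄max s hs
      have a4 := hv₄max t ht
      have a5 := hu₅max u₁ hu₁
      have a6 := hu₃max u₂ hu₂
      have a7 := hv₅max v hv
      have a8 := hv₃max v hv
      have a9 := hv₄max v hv
      have a10 := hu₃max u₄ hu₄
      have a11 := hu₄max u₃ hu₃
      have a12 := hv₃max v₄ hv₄
      have b1 : u₃.1 + v₃.1 = 0 := by omega
      have b2 : u₄.1 + v₄.1 = 0 := by omega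
      have b3 := E3.2.2.2 b1
      have b4 := E4.2.2.2 b2
      ext <;> omega
    rw [eq_single_of_support_subset hsingle]
    exact isUnit_single (Finsupp.mem_support_iff.1 hv₃)

end Supports

/-! ### Torus automorphisms as affine maps of the lattice -/

section Automorphisms

/-- An automorphism of the torus permutes the monomials, up to scalars, by an automorphism of the
lattice. -/
theorem exists_lattice_automorphism (σ : LaurentRing k ≃ₐ[k] LaurentRing k) :
    ∃ (A : ℤ × ℤ ≃+ ℤ × ℤ) (χ : ℤ × ℤ → k), (∀ u, χ u ≠ 0) ∧
      ∀ (f : LaurentRing k) (u : ℤ × ℤ), (σ f).coeff (A u) = f.coeff u * χ u := by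
  classical
  -- Monomials are units and units are monomials, so monomials map to monomials; the inverse
  -- automorphism supplies the inverse map on exponents.
  have key : ∀ τ : LaurentRing k ≃ₐ[k] LaurentRing k, ∀ u : ℤ × ℤ, ∃ (v : ℤ × ℤ) (c : k),
      c ≠ 0 ∧ τ (single u 1) = single v c := fun τ u =>
    exists_eq_single_of_isUnit ((isUnit_single one_ne_zero).map τ)
  choose A χ hχ hA using key σ
  choose B ψ hψ hB using key σ.symm
  have hsmul : ∀ (τ : LaurentRing k ≃ₐ[k] LaurentRing k) (u : ℤ × ℤ) (r : k),
      τ (single u r) = r • τ (single u 1) := by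
    intro τ u r
    rw [← map_smul, smul_single, smul_eq_mul, mul_one]
  have hBA : ∀ u, B (A u) = u := by
    intro u
    have h1 : σ.symm (σ (single u 1)) = single u 1 := σ.symm_apply_apply _
    rw [hA, hsmul, hB, smul_single, single_inj] at h1
    rcases h1 with h1 | h1
    · exact h1.1
    · exact absurd h1.2 one_ne_zero
  have hAB : ∀ u, A (B u) = u := by
    intro u
    have h1 : σ (σ.symm (single u 1)) = single u 1 := σ.apply_symm_apply _
    rw [hB, hsmul, hA, smul_single, single_inj] at h1
    rcases h1 with h1 | h1
    · exact h1.1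
    · exact absurd h1.2 one_ne_zero
  have hadd : ∀ u v, A (u + v) = A u + A v := by
    intro u v
    have h1 : σ (single (u + v) 1) = σ (single u 1) * σ (single v 1) := by
      rw [← map_mul, single_mul_single, one_mul]
    rw [hA, hA, hA, single_mul_single, single_inj] at h1
    rcases h1 with h1 | h1
    · exact h1.1
    · exact absurd h1.1 (hχ _)
  refine ⟨⟨⟨A, B, hBA, hAB⟩, hadd⟩, χ, hχ, ?_⟩
  intro f u
  change (σ f).coeff (A u) = f.coeff u * χ u
  have hinj : Function.Injective A := Function.LeftInverse.injective hBA
  induction f using AddMonoidAlgebra.induction_linear with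
  | zero => simp
  | add f g hf hg => simp [hf, hg, add_mul]
  | single v r =>
    rw [hsmul, hA, smul_single, coeff_single, coeff_single, Finsupp.single_apply, Finsupp.single_apply]
    by_cases h : v = u
    · subst h; simp
    · rw [if_neg h, if_neg (hinj.ne h), zero_mul]

/-- The supports of isomorphic curves are related by an affine automorphism of the lattice. -/
theorem IsomorphicCurves.exists_affine {f g : LaurentRing k} (h : IsomorphicCurves f g) :
    ∃ a b c e d₁ d₂ : ℤ, (a * e - b * c = 1 ∨ a * e - b * c = -1) ∧
      ∀ x y : ℤ, (x, y) ∈ f.coeff.support ↔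
        (a * x + b * y + d₁, c * x + e * y + d₂) ∈ g.coeff.support := by
  obtain ⟨σ, hσ⟩ := h
  obtain ⟨A, χ, hχ, hA⟩ := exists_lattice_automorphism σ
  rw [Ideal.map_span, Set.image_singleton, Ideal.span_singleton_eq_span_singleton] at hσ
  obtain ⟨w, hw⟩ := hσ
  obtain ⟨d, r, hr, hd⟩ := exists_eq_single_of_isUnit w.isUnit
  have hlin : ∀ (C : ℤ × ℤ ≃+ ℤ × ℤ) (x y : ℤ),
      C (x, y) = ((C (1, 0)).1 * x + (C (0, 1)).1 * y, (C (1, 0)).2 * x + (C (0, 1)).2 * y) := by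
    intro C x y
    have : (x, y) = x • ((1, 0) : ℤ × ℤ) + y • ((0, 1) : ℤ × ℤ) := by ext <;> simp
    rw [this, map_add, map_zsmul, map_zsmul]
    ext <;> simp [mul_comm]
  refine ⟨(A (1, 0)).1, (A (0, 1)).1, (A (1, 0)).2, (A (0, 1)).2, d.1, d.2, ?_, ?_⟩
  · have h1 : A (A.symm (1, 0)) = (1, 0) := A.apply_symm_apply _
    have h2 : A (A.symm (0, 1)) = (0, 1) := A.apply_symm_apply _
    rw [← Prod.mk.eta (p := A.symm (1, 0)), hlin A, Prod.mk.injEq] at h1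
    rw [← Prod.mk.eta (p := A.symm (0, 1)), hlin A, Prod.mk.injEq] at h2
    apply Int.isUnit_iff.1
    refine IsUnit.of_mul_eq_one ((A.symm (1, 0)).1 * (A.symm (0, 1)).2 -
      (A.symm (1, 0)).2 * (A.symm (0, 1)).1) ?_
    obtain ⟨p1, p2⟩ := h1
    obtain ⟨q1, q2⟩ := h2
    generalize (A (1, 0)).1 = a at *
    generalize (A (0, 1)).1 = b at *
    generalize (A (1, 0)).2 = c at *
    generalize (A (0, 1)).2 = e at *
    generalize (A.symm (1, 0)).1 = a' at *
    generalize (A.symm (0, 1)).1 = b' at *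
    generalize (A.symm (1, 0)).2 = c' at *
    generalize (A.symm (0, 1)).2 = e' at *
    linear_combination (c * b' + e * e') * p1 + q2 - (a * b' + b * e') * p2
  · intro x y
    have h1 : ((A (1, 0)).1 * x + (A (0, 1)).1 * y + d.1,
        (A (1, 0)).2 * x + (A (0, 1)).2 * y + d.2) = A (x, y) + d := by
      rw [hlin A x y]; rfl
    have hw' : σ f * single d r = g := by rw [← hd]; exact hw
    rw [h1, Finsupp.mem_support_iff, Finsupp.mem_support_iff, ← hw', coeff_mul_single_apply,
      add_neg_cancel_right, hA]
    simp [hr, hχ]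

end Automorphisms

/-! ### Moments of coefficients against polynomial functions -/

section Moments

/-- The moment `∑ c_u p(u)` of the Laurent polynomial `∑ c_u x^u` against the function `p`. -/
def moment (p : ℤ × ℤ → k) (f : LaurentRing k) : k :=
  f.coeff.sum fun u c => c * p u

theorem moment_add (p : ℤ × ℤ → k) (f g : LaurentRing k) :
    moment p (f + g) = moment p f + moment p g := by
  unfold moment
  rw [coeff_add]
  exact Finsupp.sum_add_index' (fun _ => zero_mul _) (fun _ _ _ => add_mul _ _ _)

theorem moment_zero (p : ℤ × ℤ → k) : moment p (0 : LaurentRing k) = 0 := by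
  simp [moment]

theorem moment_single (p : ℤ × ℤ → k) (u : ℤ × ℤ) (c : k) :
    moment p (single u c : LaurentRing k) = c * p u := by
  simp [moment]

theorem moment_eq_sum (p : ℤ × ℤ → k) (f : LaurentRing k) :
    moment p f = ∑ u ∈ f.coeff.support, f.coeff u * p u := rfl

/-- Multiplication by x^v - 1 is adjoint to the difference operator in direction v. -/
theorem moment_single_sub_one_mul (p : ℤ × ℤ → k) (v : ℤ × ℤ) (f : LaurentRing k) :
    moment p ((single v 1 - 1) * f) = moment (fun u => p (u + v) - p u) f := by
  induction f using AddMonoidAlgebra.induction_linear with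
  | zero => simp [moment_zero]
  | add f g hf hg => rw [mul_add, moment_add, moment_add, hf, hg]
  | single u c =>
    have h : (single v 1 - 1 : LaurentRing k) * single u c
        = single (u + v) c + single u (-c) := by
      rw [sub_mul, one_mul, single_mul_single, one_mul, add_comm v u, single_neg, sub_eq_add_neg]
    rw [h, moment_add, moment_single, moment_single, moment_single]
    ring

/-- The functions on the lattice given by polynomials of degree less than `m`, characterised by
iterated differences. -/
def DegreeLT : ℕ → (ℤ × ℤ → k) → Prop
  | 0, p => p = 0
  | m + 1, p => ∀ v, DegreeLT m fun u => p (u + v) - p u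

theorem DegreeLT.zero (m : ℕ) : DegreeLT m (0 : ℤ × ℤ → k) := by
  induction m with
  | zero => rfl
  | succ m ih =>
    intro v
    convert ih using 1
    funext u
    simp

theorem DegreeLT.add {m : ℕ} {p q : ℤ × ℤ → k} (hp : DegreeLT m p) (hq : DegreeLT m q) :
    DegreeLT m fun u => p u + q u := by
  induction m generalizing p q with
  | zero =>
    rw [DegreeLT] at hp hq
    subst hp hq
    funext u
    simp
  | succ m ih =>
    intro v
    convert ih (hp v) (hq v) using 1
    funext u
    ring

theorem DegreeLT.const_mul {m : ℕ} {p : ℤ × ℤ → k} (hp : DegreeLT m p) (c : k) :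
    DegreeLT m fun u => c * p u := by
  induction m generalizing p with
  | zero =>
    rw [DegreeLT] at hp
    subst hp
    funext u
    simp
  | succ m ih =>
    intro v
    convert ih (hp v) using 1
    funext u
    ring

/-- Leibniz rule for differences: the difference of ℓp is a translate of ℓ times the difference of
p, plus a constant times p. The translate changes the constant term, so the induction generalizes
`c`. -/
theorem DegreeLT.affine_mul {m : ℕ} {p : ℤ × ℤ → k} (hp : DegreeLT m p) (a b c : k) :
    DegreeLT (m + 1) fun u => (a * u.1 + b * u.2 + c) * p u := by
  induction m generalizing p c with
  | zero =>
    rw [DegreeLT] at hp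
    subst hp
    convert DegreeLT.zero (k := k) 1 using 1
    funext u
    simp
  | succ m ih =>
    intro v
    convert (ih (hp v) (a * v.1 + b * v.2 + c)).add (hp.const_mul (a * v.1 + b * v.2)) using 1
    funext u
    simp only [Prod.fst_add, Prod.snd_add, Int.cast_add]
    ring

theorem DegreeLT.one : DegreeLT 1 fun _ : ℤ × ℤ => (1 : k) := by
  intro v
  funext u
  simp

theorem DegreeLT.prod_affine_mul {ι : Type*} (s : Finset ι) (a b c : ι → k) {m : ℕ}
    {p : ℤ × ℤ → k} (hp : DegreeLT m p) :
    DegreeLT (s.card + m) fun u => (∏ i ∈ s, (a i * u.1 + b i * u.2 + c i)) * p u := by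
  classical
  induction s using Finset.induction_on with
  | empty => simpa using hp
  | insert i s hi ih =>
    rw [Finset.card_insert_of_notMem hi, add_right_comm]
    convert ih.affine_mul (a i) (b i) (c i) using 1
    funext u
    rw [Finset.prod_insert hi, mul_assoc]

/-- Each generator of the ideal of e turns into one difference of `p`, and m differences annihilate
a polynomial of degree less than m. -/
theorem moment_eq_zero {m : ℕ} {p : ℤ × ℤ → k} (hp : DegreeLT m p) {f : LaurentRing k}
    (hf : f ∈ idealE k ^ m) : moment p f = 0 := by
  induction m generalizing p f with
  | zero =>
    rw [DegreeLT] at hp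
    subst hp
    simp [moment]
  | succ m ih =>
    rw [pow_succ] at hf
    refine Submodule.mul_induction_on hf ?_ ?_
    · intro h hh g hg
      obtain ⟨a, b, rfl⟩ := Ideal.mem_span_pair.1 hg
      have e : h * (a * (single (1, 0) 1 - 1) + b * (single (0, 1) 1 - 1))
          = (single (1, 0) 1 - 1) * (a * h) + (single (0, 1) 1 - 1) * (b * h) := by ring
      rw [e, moment_add, moment_single_sub_one_mul, moment_single_sub_one_mul,
        ih (hp _) (Ideal.mul_mem_left _ _ hh), ih (hp _) (Ideal.mul_mem_left _ _ hh), add_zero]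
    · intro f g hf hg
      rw [moment_add, hf, hg, add_zero]

end Moments

/-! ### Taylor expansion at e -/

section Taylor

/-- A polynomial all of whose binomial moments of order less than `m` vanish lies in the `m`-th
power of the ideal of `e`. -/
theorem sum_single_mem_idealE_pow {m : ℕ} (T : Finset (ℕ × ℕ)) (c : ℕ × ℕ → k)
    (hc : ∀ i j : ℕ, i + j < m →
      ∑ p ∈ T, c p * ((p.1.choose i : k) * (p.2.choose j : k)) = 0) :
    ∑ p ∈ T, (single ((p.1 : ℤ), (p.2 : ℤ)) (c p) : LaurentRing k) ∈ idealE k ^ m := by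
  set s : LaurentRing k := single (1, 0) 1 - 1 with hs
  set t : LaurentRing k := single (0, 1) 1 - 1 with ht
  have hsI : s ∈ idealE k := Ideal.subset_span (by simp [hs])
  have htI : t ∈ idealE k := Ideal.subset_span (by simp [ht])
  obtain ⟨B, hB⟩ : ∃ B : ℕ, ∀ p ∈ T, p.1 < B ∧ p.2 < B := by
    refine ⟨T.sup (fun p => p.1 + p.2) + 1, fun p hp => ?_⟩
    have : p.1 + p.2 ≤ T.sup fun p => p.1 + p.2 :=
      Finset.le_sup (f := fun p : ℕ × ℕ => p.1 + p.2) hp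
    omega
  have hbin : ∀ (r : LaurentRing k) (a : ℕ), a < B →
      (r + 1) ^ a = ∑ i ∈ Finset.range B, r ^ i * (a.choose i : LaurentRing k) := by
    intro r a ha
    rw [add_pow]
    simp only [one_pow, mul_one]
    refine Finset.sum_subset (fun i hi => ?_) (fun i _ hi => ?_)
    · simp only [Finset.mem_range] at hi ⊢; omega
    · simp only [Finset.mem_range] at hi
      rw [Nat.choose_eq_zero_of_lt (by omega)]; simp
  -- Taylor expansion of a monomial in s = x - 1 and t = y - 1. The common bound `B` makes the index
  -- set independent of the monomial, so that the sums can be exchanged.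
  have hmono : ∀ p ∈ T, (single ((p.1 : ℤ), (p.2 : ℤ)) (c p) : LaurentRing k) =
      ∑ i ∈ Finset.range B, ∑ j ∈ Finset.range B,
        (c p * ((p.1.choose i : k) * (p.2.choose j : k))) • (s ^ i * t ^ j) := by
    intro p hp
    have h1 : (single ((p.1 : ℤ), (p.2 : ℤ)) (c p) : LaurentRing k) =
        c p • ((s + 1) ^ p.1 * (t + 1) ^ p.2) := by
      simp only [hs, ht, sub_add_cancel]
      rw [single_pow, single_pow, single_mul_single, smul_single]
      simp
    rw [h1, hbin s _ (hB p hp).1, hbin t _ (hB p hp).2, Finset.sum_mul_sum, Finset.smul_sum]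
    refine Finset.sum_congr rfl fun i _ => ?_
    rw [Finset.smul_sum]
    refine Finset.sum_congr rfl fun j _ => ?_
    rw [mul_smul]
    congr 1
    rw [Algebra.smul_def, map_mul, map_natCast, map_natCast]
    ring
  rw [Finset.sum_congr rfl hmono, Finset.sum_comm]
  refine Ideal.sum_mem _ fun i _ => ?_
  rw [Finset.sum_comm]
  refine Ideal.sum_mem _ fun j _ => ?_
  rw [← Finset.sum_smul]
  by_cases hij : i + j < m
  · rw [hc i j hij, zero_smul]
    exact Ideal.zero_mem _
  · refine Submodule.smul_of_tower_mem _ _ (Ideal.pow_le_pow_right (not_lt.1 hij) ?_)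
    rw [pow_add]
    exact Ideal.mul_mem_mul (Ideal.pow_mem_pow hsI i) (Ideal.pow_mem_pow htI j)

end Taylor

/-! ### Lattice width of irreducible polynomials -/

section Width

/-- If the coefficients of `f` along every line in direction `v` sum to zero, then `x^v - 1`
divides `f`. The lines are the level sets of the functional `(a, b)`, and `v = (-b, a)`. -/
theorem dvd_of_level_sums_eq_zero {a b s t : ℤ} (hst : a * s + b * t = 1) {f : LaurentRing k}
    (hf : ∀ l : ℤ, ∑ u ∈ f.coeff.support with a * u.1 + b * u.2 = l, f.coeff u = 0) :
    (single (-b, a) 1 - 1 : LaurentRing k) ∣ f := by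
  classical
  rw [← Ideal.mem_span_singleton]
  set J : Ideal (LaurentRing k) := Ideal.span {single (-b, a) 1 - 1} with hJ
  have hgen : (single (-b, a) 1 - 1 : LaurentRing k) ∈ J := Ideal.subset_span rfl
  have hnat : ∀ j : ℕ, ∀ u : ℤ × ℤ, ∀ c : k,
      (single (u + j • (-b, a)) c - single u c : LaurentRing k) ∈ J := by
    intro j u c
    induction j with
    | zero => simp
    | succ j ih =>
      have e : (single (u + (j + 1) • (-b, a)) c - single u c : LaurentRing k) =
          single (u + j • (-b, a)) c * (single (-b, a) 1 - 1) +
            (single (u + j • (-b, a)) c - single u c) := by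
        rw [mul_sub, mul_one, single_mul_single, mul_one, succ_nsmul, add_assoc]
        ring
      rw [e]
      exact J.add_mem (J.mul_mem_left _ hgen) ih
  have hzmul : ∀ j : ℤ, ∀ u : ℤ × ℤ, ∀ c : k,
      (single (u + j • (-b, a)) c - single u c : LaurentRing k) ∈ J := by
    intro j u c
    obtain ⟨n, rfl | rfl⟩ := j.eq_nat_or_neg
    · simpa using hnat n u c
    · have := hnat n (u + (-(n : ℤ)) • (-b, a)) c
      rw [add_assoc, ← natCast_zsmul, ← add_smul, neg_add_cancel, zero_smul, add_zero] at this
      rw [← neg_sub]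
      exact J.neg_mem this
  -- Modulo x^v - 1, every monomial on level l equals the representative with exponent l(s,t), so
  -- the class of `f` depends only on its level sums.
  have hrep : ∀ u : ℤ × ℤ, ∀ c : k, (single u c -
      single ((a * u.1 + b * u.2) • ((s, t) : ℤ × ℤ)) c : LaurentRing k) ∈ J := by
    intro u c
    have e : u = (a * u.1 + b * u.2) • ((s, t) : ℤ × ℤ) + (s * u.2 - t * u.1) • (-b, a) := by
      ext
      · simp only [Prod.fst_add, Prod.smul_fst, smul_eq_mul]
        linear_combination (-u.1) * hst
      · simp only [Prod.snd_add, Prod.smul_snd, smul_eq_mul]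
        linear_combination (-u.2) * hst
    conv in single u c => rw [e]
    exact hzmul _ _ _
  have hsum : ∑ u ∈ f.coeff.support,
      (single ((a * u.1 + b * u.2) • ((s, t) : ℤ × ℤ)) (f.coeff u) : LaurentRing k) = 0 := by
    rw [← Finset.sum_fiberwise_of_maps_to (t := f.coeff.support.image fun u => a * u.1 + b * u.2)
      (g := fun u => a * u.1 + b * u.2) (fun u hu => Finset.mem_image_of_mem _ hu)]
    refine Finset.sum_eq_zero fun l _ => ?_
    have : ∀ u ∈ f.coeff.support.filter (fun u => a * u.1 + b * u.2 = l),
        (single ((a * u.1 + b * u.2) • ((s, t) : ℤ × ℤ)) (f.coeff u) : LaurentRing k) =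
          singleAddHom (l • ((s, t) : ℤ × ℤ)) (f.coeff u) := by
      intro u hu
      rw [(Finset.mem_filter.1 hu).2]
      rfl
    rw [Finset.sum_congr rfl this, ← map_sum, hf l, map_zero]
  have hfs : f = ∑ u ∈ f.coeff.support, single u (f.coeff u) := (sum_coeff_single f).symm
  have : f = ∑ u ∈ f.coeff.support, (single u (f.coeff u) -
      single ((a * u.1 + b * u.2) • ((s, t) : ℤ × ℤ)) (f.coeff u)) := by
    rw [Finset.sum_sub_distrib, hsum, sub_zero]
    exact hfs
  rw [this]
  exact J.sum_mem fun u _ => hrep _ _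

/-- The Newton polygon of an irreducible Laurent polynomial vanishing to order `m ≥ 2` at `e` has
width at least `m` in every direction. -/
theorem exists_width_ge [CharZero k] {f : LaurentRing k} {m : ℕ} (hm : 2 ≤ m)
    (hirr : Irreducible f) (hf : f ∈ idealE k ^ m) {a b : ℤ} (hab : IsCoprime a b) :
    ∃ u ∈ f.coeff.support, ∃ v ∈ f.coeff.support,
      (a * u.1 + b * u.2) + m ≤ a * v.1 + b * v.2 := by
  classical
  by_contra! hcon
  have hne : f.coeff.support.Nonempty := by
    rw [Finsupp.support_nonempty_iff, Ne, coeff_eq_zero]; exact hirr.ne_zero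
  obtain ⟨u₀, hu₀, hmin⟩ := f.coeff.support.exists_min_image (fun u => a * u.1 + b * u.2) hne
  set l₀ := a * u₀.1 + b * u₀.2 with hl₀
  have hlev : ∀ l : ℤ, ∑ u ∈ f.coeff.support with a * u.1 + b * u.2 = l, f.coeff u = 0 := by
    intro l
    by_cases hl : l ∈ Finset.Ico l₀ (l₀ + m)
    -- If the width is less than m, only m levels occur. The product of the linear forms for the m -
    -- 1 other levels has degree less than m, and its moment is a nonzero multiple of the sum on
    -- level l.
    · set S := (Finset.Ico l₀ (l₀ + m)).erase l with hS
      have hcard : S.card + 1 = m := by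
        rw [hS, Finset.card_erase_add_one hl, Int.card_Ico]
        simp
      have hdeg := DegreeLT.prod_affine_mul S (fun _ => (a : k)) (fun _ => (b : k))
        (fun j => -(j : k)) DegreeLT.one
      rw [hcard] at hdeg
      have h0 := moment_eq_zero hdeg hf
      rw [moment_eq_sum, ← Finset.sum_filter_add_sum_filter_not _
        (fun u => a * u.1 + b * u.2 = l)] at h0
      have h1 : ∑ u ∈ f.coeff.support with ¬ (a * u.1 + b * u.2 = l), f.coeff u *
          ((∏ j ∈ S, ((a : k) * (u.1 : k) + (b : k) * (u.2 : k) + -(j : k))) * 1) = 0 := by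
        refine Finset.sum_eq_zero fun u hu => ?_
        obtain ⟨hu, hul⟩ := Finset.mem_filter.1 hu
        have hmem : a * u.1 + b * u.2 ∈ S := by
          rw [hS, Finset.mem_erase, Finset.mem_Ico]
          exact ⟨hul, hmin u hu, hcon u₀ hu₀ u hu⟩
        rw [Finset.prod_eq_zero hmem (by push_cast; ring), zero_mul, mul_zero]
      have h2 : ∑ u ∈ f.coeff.support with a * u.1 + b * u.2 = l, f.coeff u *
          ((∏ j ∈ S, ((a : k) * (u.1 : k) + (b : k) * (u.2 : k) + -(j : k))) * 1) =
          (∑ u ∈ f.coeff.support with a * u.1 + b * u.2 = l, f.coeff u) *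
            ∏ j ∈ S, ((l : k) - (j : k)) := by
        rw [Finset.sum_mul]
        refine Finset.sum_congr rfl fun u hu => ?_
        rw [mul_one, ← (Finset.mem_filter.1 hu).2]
        push_cast
        simp only [sub_eq_add_neg]
      rw [h1, h2, add_zero] at h0
      refine (mul_eq_zero.1 h0).resolve_right (Finset.prod_ne_zero_iff.2 fun j hj => ?_)
      rw [sub_ne_zero]
      exact_mod_cast (Finset.ne_of_mem_erase hj).symm
    · rw [Finset.filter_false_of_mem, Finset.sum_empty]
      intro u hu hul
      exact hl (hul ▸ Finset.mem_Ico.2 ⟨hmin u hu, hcon u₀ hu₀ u hu⟩)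
  obtain ⟨s, t, hst⟩ := hab
  obtain ⟨h, hh⟩ := dvd_of_level_sums_eq_zero (a := a) (b := b) (s := s) (t := t)
    (by linarith) hlev
  have hab0 : (-b, a) ≠ (0 : ℤ × ℤ) := by
    rintro h0
    obtain ⟨h1, h2⟩ := Prod.mk.inj h0
    have hb : b = 0 := by linarith
    subst hb
    simp_all
  -- One factor is a unit. It cannot be x^v - 1, which vanishes at e; and if it is the cofactor,
  -- then `f` is a monomial times x^v - 1, whose first moments do not both vanish, against m ≥ 2.
  rcases hirr.isUnit_or_isUnit hh with hu | hu
  · obtain ⟨w, c, hc, hw⟩ := exists_eq_single_of_isUnit hu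
    have h1 := congrArg (moment fun _ => (1 : k)) hw
    have h2 := moment_single_sub_one_mul (fun _ => (1 : k)) (-b, a) (1 : LaurentRing k)
    rw [mul_one, h1, moment_single] at h2
    simp [moment] at h2
    exact hc h2
  · obtain ⟨w, c, hc, hw⟩ := exists_eq_single_of_isUnit hu
    have hf2 : f ∈ idealE k ^ 2 := Ideal.pow_le_pow_right hm hf
    have hx : DegreeLT 2 fun u : ℤ × ℤ => ((1 : k) * u.1 + 0 * u.2 + 0) * 1 :=
      DegreeLT.one.affine_mul 1 0 0
    have hy : DegreeLT 2 fun u : ℤ × ℤ => ((0 : k) * u.1 + 1 * u.2 + 0) * 1 :=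
      DegreeLT.one.affine_mul 0 1 0
    have hx0 := moment_eq_zero hx hf2
    have hy0 := moment_eq_zero hy hf2
    rw [hh, hw, moment_single_sub_one_mul, moment_single] at hx0 hy0
    apply hab0
    simp [hc] at hx0 hy0
    simp [hx0, hy0]

end Width

/-! ### Column counts and existence of curves in admissible triangles -/

section Triangles

/-- Numerical conditions on the triangle with vertices `(0, 0)`, `(m, n)` and `(m - n / K, 0)` which
ensure that its columns have `1, 1, 2, …, m` lattice points, in some order. -/
structure IsAdmissible (m n K : ℤ) : Prop where
  m_pos : 0 < m
  n_pos : 0 < n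
  n_lt : n < K * m
  coprime : IsCoprime m n
  -- Twice the area of the triangle is n(Km - n)/K = m² - δ/K.
  exists_defect : ∃ δ, 0 < δ ∧ δ ≤ K ∧ n * (K * m - n) = K * m ^ 2 - δ

/-- The lattice points of the triangle with vertices `(0, 0)`, `(m, n)` and `(m - n / K, 0)`. -/
def InTriangle (m n K : ℤ) (u : ℤ × ℤ) : Prop :=
  0 ≤ u.2 ∧ n + K * (u.1 - m) ≤ u.2 ∧ m * u.2 ≤ n * u.1

variable {m n K : ℤ}

theorem InTriangle.fst_nonneg (h : IsAdmissible m n K) {u : ℤ × ℤ} (hu : InTriangle m n K u) :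
    0 ≤ u.1 := by
  obtain ⟨h1, h2, h3⟩ := hu
  have := h.m_pos
  have := h.n_pos
  by_contra hneg
  push Not at hneg
  nlinarith

theorem InTriangle.fst_le (h : IsAdmissible m n K) {u : ℤ × ℤ} (hu : InTriangle m n K u) :
    u.1 ≤ m := by
  obtain ⟨h1, h2, h3⟩ := hu
  have hm := h.m_pos
  have hn := h.n_lt
  by_contra hneg
  push Not at hneg
  nlinarith [mul_le_mul_of_nonneg_left h2 hm.le, mul_pos (sub_pos.2 hn) (sub_pos.2 hneg)]

theorem InTriangle.eq_of_fst_eq_zero (h : IsAdmissible m n K) {u : ℤ × ℤ}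
    (hu : InTriangle m n K u) (h0 : u.1 = 0) : u = (0, 0) := by
  obtain ⟨h1, h2, h3⟩ := hu
  have hm := h.m_pos
  rw [h0, mul_zero] at h3
  ext
  · exact h0
  · exact le_antisymm (by by_contra hneg; push Not at hneg; nlinarith) h1

theorem InTriangle.eq_of_fst_eq (h : IsAdmissible m n K) {u : ℤ × ℤ}
    (hu : InTriangle m n K u) (h0 : u.1 = m) : u = (m, n) := by
  obtain ⟨h1, h2, h3⟩ := hu
  have hm := h.m_pos
  rw [h0, sub_self, mul_zero, add_zero] at h2
  rw [h0] at h3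
  ext
  · exact h0
  · exact le_antisymm (by by_contra hneg; push Not at hneg; nlinarith) h2

theorem exists_ceil {a b : ℤ} (hb : 0 < b) :
    ∃ C : ℤ, (∀ i, a ≤ i * b ↔ C ≤ i) ∧ a ≤ C * b ∧ C * b ≤ a + b - 1 := by
  have h1 : a ≤ (-(-a / b)) * b := by
    have := Int.ediv_mul_le (-a) hb.ne'
    linarith
  have h2 : (-(-a / b)) * b ≤ a + b - 1 := by
    have := Int.lt_ediv_add_one_mul_self (-a) hb
    linarith
  refine ⟨-(-a / b), fun i => ⟨fun hi => ?_, fun hi => ?_⟩, h1, h2⟩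
  · by_contra hneg
    push Not at hneg
    nlinarith
  · nlinarith

/-- The number of columns with more than `s` points. -/
theorem IsAdmissible.exists_columns (h : IsAdmissible m n K) {s : ℤ} (hs : 0 < s) (hsm : s < m) :
    ∃ C₁ C₂ : ℤ, (∀ i, s * m ≤ i * n ↔ C₁ ≤ i) ∧ (∀ j, s * m ≤ j * (K * m - n) ↔ C₂ ≤ j) ∧
      C₁ + C₂ = s + 1 := by
  have hm := h.m_pos
  have hn := h.n_pos
  have hn' : 0 < K * m - n := sub_pos.2 h.n_lt
  obtain ⟨δ, hδ, hδK, hdef⟩ := h.exists_defect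
  obtain ⟨C₁, h1, h1a, h1b⟩ := exists_ceil (a := s * m) hn
  obtain ⟨C₂, h2, h2a, h2b⟩ := exists_ceil (a := s * m) hn'
  refine ⟨C₁, C₂, h1, h2, ?_⟩
  have hP : 0 < n * (K * m - n) := mul_pos hn hn'
  -- With P = n(Km - n) = Km² - δ, the two ceilings add up to at least s(P + δ)/P > s, and to at
  -- most s + 2 + (sδ - Km)/P. The latter is below s + 2 because s < m and δ ≤ K.
  have hlow : n * (K * m - n) * s < n * (K * m - n) * (C₁ + C₂) := by
    nlinarith [mul_le_mul_of_nonneg_left h1a hn'.le, mul_le_mul_of_nonneg_left h2a hn.le,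
      mul_pos hs hδ]
  have hup : n * (K * m - n) * (C₁ + C₂) < n * (K * m - n) * (s + 2) := by
    have e1 : s * δ < K * m := by nlinarith
    have e2 : n * (K * m - n) * s = s * (K * m ^ 2 - δ) := by rw [hdef]; ring
    nlinarith [mul_le_mul_of_nonneg_left h1b hn'.le, mul_le_mul_of_nonneg_left h2b hn.le]
  have := lt_of_mul_lt_mul_left hlow hP.le
  have := lt_of_mul_lt_mul_left hup hP.le
  linarith

/-- The number of lattice points in a column of the triangle. -/
def columnSize (m n K i : ℤ) : ℤ := min (i * n / m) ((m - i) * (K * m - n) / m) + 1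

/-- The lower sides have slopes 0 and K and meet every column at integral heights. So a column has
more than s points exactly when the upper edge is at least s above both of them. -/
theorem lt_columnSize_iff (hm : 0 < m) {i s : ℤ} :
    s < columnSize m n K i ↔ s * m ≤ i * n ∧ s * m ≤ (m - i) * (K * m - n) := by
  rw [columnSize, Int.lt_add_one_iff, le_min_iff, Int.le_ediv_iff_mul_le hm,
    Int.le_ediv_iff_mul_le hm]

theorem InTriangle.mem_Ioc (h : IsAdmissible m n K) {u : ℤ × ℤ} (hu : InTriangle m n K u) :
    u.2 ∈ Finset.Ioc (u.1 * n / m - columnSize m n K u.1) (u.1 * n / m) := by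
  obtain ⟨h1, h2, h3⟩ := hu
  have hm := h.m_pos
  have htop : u.2 ≤ u.1 * n / m := by
    rw [Int.le_ediv_iff_mul_le hm]; linarith
  refine Finset.mem_Ioc.2 ⟨?_, htop⟩
  have : u.1 * n / m - u.2 < columnSize m n K u.1 := by
    rw [lt_columnSize_iff hm]
    have := Int.ediv_mul_le (u.1 * n) hm.ne'
    constructor
    · nlinarith
    · nlinarith [mul_le_mul_of_nonneg_right h2 hm.le]
  linarith

theorem columnSize_pos (h : IsAdmissible m n K) {i : ℤ} (h0 : 0 ≤ i) (him : i ≤ m) :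
    0 < columnSize m n K i := by
  rw [lt_columnSize_iff h.m_pos, zero_mul]
  exact ⟨mul_nonneg h0 h.n_pos.le,
    mul_nonneg (sub_nonneg.2 him) (sub_nonneg.2 h.n_lt.le)⟩

/-- A longer column would force Km² ≤ n(Km - n), against δ > 0. -/
theorem columnSize_le (h : IsAdmissible m n K) {i : ℤ} :
    columnSize m n K i ≤ m := by
  by_contra hlt
  push Not at hlt
  rw [lt_columnSize_iff h.m_pos] at hlt
  obtain ⟨h1, h2⟩ := hlt
  obtain ⟨δ, hδ, -, hdef⟩ := h.exists_defect
  have hm := h.m_pos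
  have hn := h.n_pos
  have hn' : 0 < K * m - n := sub_pos.2 h.n_lt
  nlinarith [mul_le_mul_of_nonneg_left h1 hn'.le, mul_le_mul_of_nonneg_left h2 hn.le,
    mul_pos hm hδ]

/-- Deleting an extreme column, which has one point, turns the sizes 1, 1, 2, ..., m into 1, 2, ...,
m. The deletion matters only for s = 1. -/
theorem card_columns_le (h : IsAdmissible m n K) {s : ℤ} (hs : 0 < s) (hsm : s ≤ m) {e : ℤ}
    (he : e = 0 ∨ e = m) :
    ((((Finset.Icc 0 m).erase e).filter fun j => s ≤ columnSize m n K j).card : ℤ)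
      ≤ m - s + 1 := by
  have hm := h.m_pos
  rcases eq_or_lt_of_le (show 1 ≤ s from hs) with rfl | hs1
  · have hmem : e ∈ Finset.Icc 0 m := by
      rw [Finset.mem_Icc]; rcases he with rfl | rfl <;> constructor <;> omega
    have h1 := Finset.card_filter_le ((Finset.Icc 0 m).erase e)
      (fun j => 1 ≤ columnSize m n K j)
    have h2 := Finset.card_erase_add_one hmem
    rw [Int.card_Icc] at h2
    omega
  · obtain ⟨C₁, C₂, hC₁, hC₂, hC⟩ := h.exists_columns (s := s - 1) (by omega) (by omega)
    have hsub : ((Finset.Icc 0 m).erase e).filter (fun j => s ≤ columnSize m n K j) ⊆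
        Finset.Icc C₁ (m - C₂) := by
      intro j hj
      have hj' := (Finset.mem_filter.1 hj).2
      have : s - 1 < columnSize m n K j := by omega
      rw [lt_columnSize_iff hm, hC₁, hC₂] at this
      rw [Finset.mem_Icc]
      omega
    have h1 := Finset.card_le_card hsub
    rw [Int.card_Icc] at h1
    omega

/-- A Laurent polynomial supported in an admissible triangle and vanishing to order `m` at `e` is
zero if it misses one of the two extreme columns. -/
theorem eq_zero_of_missing_column [CharZero k] {m : ℕ} {n K : ℤ} (h : IsAdmissible m n K)
    {f : LaurentRing k} (hf : f ∈ idealE k ^ m)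
    (hsupp : ∀ u ∈ f.coeff.support, InTriangle m n K u) {e : ℤ} (he : e = 0 ∨ e = m)
    (hmiss : ∀ u ∈ f.coeff.support, u.1 ≠ e) : f = 0 := by
  classical
  have hm := h.m_pos
  suffices H : ∀ s : ℕ, ∀ u ∈ f.coeff.support, columnSize m n K u.1 ≠ s by
    rw [← coeff_eq_zero, ← Finsupp.support_eq_empty, Finset.eq_empty_iff_forall_notMem]
    intro u hu
    have hpos := columnSize_pos h ((hsupp u hu).fst_nonneg h) ((hsupp u hu).fst_le h)
    exact H (columnSize m n K u.1).toNat u hu (by omega)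
  intro s
  induction s using Nat.strong_induction_on with
  | _ s ih =>
  intro u hu hus
  have hx0 := (hsupp u hu).fst_nonneg h
  have hxm := (hsupp u hu).fst_le h
  have hpos := columnSize_pos h hx0 hxm
  have hle := columnSize_le h (i := u.1)
  -- By induction no smaller column meets the support. The at most m - s other columns in `J` and
  -- the s - 1 other places in `Y` are cut out by linear forms of total degree at most m - 1; the
  -- resulting moment is a nonzero multiple of the coefficient at `u`.
  set J := (((Finset.Icc 0 (m : ℤ)).erase e).filter
    fun j => (s : ℤ) ≤ columnSize m n K j).erase u.1 with hJ
  set Y := (Finset.Ioc (u.1 * n / m - columnSize m n K u.1) (u.1 * n / m)).erase u.2 with hY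
  have huJ : u.1 ∈ ((Finset.Icc 0 (m : ℤ)).erase e).filter
      fun j => (s : ℤ) ≤ columnSize m n K j := by
    simp only [Finset.mem_filter, Finset.mem_erase, Finset.mem_Icc]
    exact ⟨⟨hmiss u hu, hx0, hxm⟩, hus.ge⟩
  have hJcard := Finset.card_erase_add_one huJ
  rw [← hJ] at hJcard
  have hYcard := Finset.card_erase_add_one ((hsupp u hu).mem_Ioc h)
  rw [← hY, Int.card_Ioc] at hYcard
  have hcol := card_columns_le h (s := s) (by omega) (by omega) he
  have hdeg := DegreeLT.prod_affine_mul J (fun _ => (1 : k)) (fun _ => (0 : k))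
    (fun j => -(j : k)) (DegreeLT.prod_affine_mul Y (fun _ => (0 : k)) (fun _ => (1 : k))
    (fun j => -(j : k)) DegreeLT.one)
  have hf' : f ∈ idealE k ^ (J.card + (Y.card + 1)) :=
    Ideal.pow_le_pow_right (by omega) hf
  have h0 := moment_eq_zero hdeg hf'
  rw [moment_eq_sum, Finset.sum_eq_single u] at h0
  · refine (mul_ne_zero (Finsupp.mem_support_iff.1 hu) (mul_ne_zero ?_ (mul_ne_zero ?_
      one_ne_zero))) h0
    · refine Finset.prod_ne_zero_iff.2 fun j hj => ?_
      have hne := Finset.ne_of_mem_erase hj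
      rw [one_mul, zero_mul, add_zero, ← sub_eq_add_neg, sub_ne_zero]
      exact_mod_cast hne.symm
    · refine Finset.prod_ne_zero_iff.2 fun j hj => ?_
      have hne := Finset.ne_of_mem_erase hj
      rw [one_mul, zero_mul, zero_add, ← sub_eq_add_neg, sub_ne_zero]
      exact_mod_cast hne.symm
  · intro v hv hvu
    by_cases hx : v.1 = u.1
    · have hy : v.2 ∈ Y := by
        rw [hY, Finset.mem_erase]
        refine ⟨fun hy => hvu (Prod.ext hx hy), ?_⟩
        have := (hsupp v hv).mem_Ioc h
        rwa [hx] at this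
      rw [Finset.prod_eq_zero hy (by simp)]
      simp
    · have hvJ : v.1 ∈ J := by
        simp only [hJ, Finset.mem_filter, Finset.mem_erase, Finset.mem_Icc]
        refine ⟨hx, ⟨hmiss v hv, (hsupp v hv).fst_nonneg h, (hsupp v hv).fst_le h⟩, ?_⟩
        by_contra hlt
        push Not at hlt
        have hvpos := columnSize_pos h ((hsupp v hv).fst_nonneg h) ((hsupp v hv).fst_le h)
        exact ih (columnSize m n K v.1).toNat (by omega) v hv (by omega)
      rw [Finset.prod_eq_zero hvJ (by simp)]
      simp
  · exact fun hu' => absurd hu hu'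

theorem mem_support_of_admissible [CharZero k] {m : ℕ} {n K : ℤ} (h : IsAdmissible m n K)
    {f : LaurentRing k} (hf0 : f ≠ 0) (hf : f ∈ idealE k ^ m)
    (hsupp : ∀ u ∈ f.coeff.support, InTriangle m n K u) :
    (0, 0) ∈ f.coeff.support ∧ ((m : ℤ), n) ∈ f.coeff.support := by
  constructor
  · by_contra hno
    refine hf0 (eq_zero_of_missing_column h hf hsupp (Or.inl rfl) fun u hu hu0 => hno ?_)
    rwa [(hsupp u hu).eq_of_fst_eq_zero h hu0] at hu
  · by_contra hno
    refine hf0 (eq_zero_of_missing_column h hf hsupp (Or.inr rfl) fun u hu hu0 => hno ?_)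
    rwa [(hsupp u hu).eq_of_fst_eq h hu0] at hu

/-- A polynomial with only one monomial, the constant one, in its first column, and contained in
the columns `0, …, m`, does not vanish to order greater than `m` at `e`. -/
theorem notMem_idealE_pow [CharZero k] {m : ℕ} {f : LaurentRing k}
    (h0 : (0, 0) ∈ f.coeff.support)
    (hsupp : ∀ u ∈ f.coeff.support, 0 ≤ u.1 ∧ u.1 ≤ m ∧ (u.1 = 0 → u = (0, 0))) :
    f ∉ idealE k ^ (m + 1) := by
  intro hf
  -- The product of x - j for j = 1, ..., m has degree m and vanishes on every column but the first.
  have hdeg := DegreeLT.prod_affine_mul (Finset.Icc 1 (m : ℤ)) (fun _ => (1 : k))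
    (fun _ => (0 : k)) (fun j => -(j : k)) DegreeLT.one
  rw [Int.card_Icc, show ((m : ℤ) + 1 - 1).toNat = m by simp] at hdeg
  have hm := moment_eq_zero hdeg hf
  rw [moment_eq_sum, Finset.sum_eq_single (0, 0)] at hm
  · refine (mul_ne_zero (Finsupp.mem_support_iff.1 h0) (mul_ne_zero ?_ one_ne_zero)) hm
    refine Finset.prod_ne_zero_iff.2 fun j hj => ?_
    have := (Finset.mem_Icc.1 hj).1
    simp only [Int.cast_zero, mul_zero, add_zero, zero_add, ne_eq, neg_eq_zero, Int.cast_eq_zero]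
    omega
  · intro u hu hu0
    obtain ⟨hx0, hxm, hx⟩ := hsupp u hu
    have hmem : u.1 ∈ Finset.Icc 1 (m : ℤ) := by
      rw [Finset.mem_Icc]
      exact ⟨by by_contra hlt; exact hu0 (hx (by omega)), hxm⟩
    rw [Finset.prod_eq_zero hmem (by simp)]
    simp
  · exact fun hno => absurd h0 hno

/-- An admissible triangle has more lattice points than there are conditions for vanishing to order
`m` at `e`. -/
theorem exists_finset_inTriangle {m : ℕ} {n K : ℤ} (h : IsAdmissible m n K) :
    ∃ T : Finset (ℕ × ℕ), (∀ p ∈ T, InTriangle m n K ((p.1 : ℤ), (p.2 : ℤ))) ∧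
      ((Finset.range m).sigma fun s => Finset.range (m - s)).card < T.card := by
  classical
  have hm := h.m_pos
  have hn := h.n_pos
  have hm' : 0 < m := by exact_mod_cast hm
  have hn' : 0 < K * m - n := sub_pos.2 h.n_lt
  -- Layer s consists of the points s steps below the top of their column. It uses m - s consecutive
  -- columns starting at `C s`, so the layers match the conditions indexed by i + j < m. Layer 0
  -- leaves out column m, whose point (m,n) is the surplus one.
  have hC : ∀ s : ℕ, ∃ C : ℤ, s < m → ∀ i : ℤ, C ≤ i → i < C + (m - s) →
      (s : ℤ) * m ≤ i * n ∧ (s : ℤ) * m ≤ (m - i) * (K * m - n) ∧ i < m := by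
    intro s
    rcases Nat.eq_zero_or_pos s with rfl | hs
    · refine ⟨0, fun _ i h1 h2 => ?_⟩
      simp only [Nat.cast_zero, zero_mul]
      exact ⟨mul_nonneg h1 hn.le, mul_nonneg (by push_cast at h2; linarith) hn'.le, by omega⟩
    · by_cases hsm : s < m
      · obtain ⟨C₁, C₂, h1, h2, h3⟩ := h.exists_columns (s := s) (by omega) (by omega)
        refine ⟨C₁, fun _ i hi hi' => ?_⟩
        have h4 : (s : ℤ) * m ≤ (m - i) * (K * m - n) := (h2 _).2 (by omega)
        refine ⟨(h1 i).2 hi, h4, ?_⟩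
        have h5 : 0 < (m - i) * (K * m - n) :=
          lt_of_lt_of_le (mul_pos (by exact_mod_cast hs) hm) h4
        linarith [pos_of_mul_pos_left h5 hn'.le]
      · exact ⟨0, fun hlt => absurd hlt hsm⟩
  choose C hC using hC
  set P : (_ : ℕ) × ℕ → ℤ × ℤ := fun x =>
    (C x.1 + x.2, (C x.1 + x.2) * n / m - x.1) with hP
  have hin : ∀ x ∈ (Finset.range m).sigma (fun s => Finset.range (m - s)),
      InTriangle m n K (P x) ∧ (P x).1 < m := by
    intro x hx
    simp only [Finset.mem_sigma, Finset.mem_range] at hx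
    obtain ⟨h1, h2, h3⟩ := hC x.1 hx.1 (C x.1 + x.2) (by omega) (by omega)
    refine ⟨⟨?_, ?_, ?_⟩, h3⟩
    · have : (x.1 : ℤ) ≤ (C x.1 + x.2) * n / m := (Int.le_ediv_iff_mul_le hm).2 h1
      simp only [hP]
      linarith
    · have : n + K * (C x.1 + x.2 - m) + x.1 ≤ (C x.1 + x.2) * n / m :=
        (Int.le_ediv_iff_mul_le hm).2 (by linarith)
      simp only [hP]
      linarith
    · have h4 := Int.ediv_mul_le ((C x.1 + x.2) * n) hm.ne'
      have h5 : (0 : ℤ) ≤ m * x.1 := by positivity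
      simp only [hP]
      linarith
  set Q : (_ : ℕ) × ℕ → ℕ × ℕ := fun x => ((P x).1.toNat, (P x).2.toNat) with hQ
  have hQP : ∀ x ∈ (Finset.range m).sigma (fun s => Finset.range (m - s)),
      (((Q x).1 : ℤ), ((Q x).2 : ℤ)) = P x := by
    intro x hx
    have h1 := (hin x hx).1.fst_nonneg h
    have h2 := (hin x hx).1.1
    ext
    · simp only [hQ]; omega
    · simp only [hQ]; omega
  have hinj : Set.InjOn Q ((Finset.range m).sigma fun s => Finset.range (m - s)) := by
    intro x hx y hy hxy
    have e : P x = P y := by rw [← hQP x hx, ← hQP y hy, hxy]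
    simp only [hP, Prod.mk.injEq] at e
    obtain ⟨e1, e2⟩ := e
    rw [e1] at e2
    have e3 : x.1 = y.1 := by omega
    obtain ⟨x1, x2⟩ := x
    obtain ⟨y1, y2⟩ := y
    simp only at e3
    subst e3
    have e4 : x2 = y2 := by simpa using e1
    rw [e4]
  refine ⟨insert (m, n.toNat) (((Finset.range m).sigma fun s => Finset.range (m - s)).image Q),
    ?_, ?_⟩
  · intro p hp
    rcases Finset.mem_insert.1 hp with rfl | hp
    · simp only [Int.toNat_of_nonneg hn.le]
      exact ⟨hn.le, by simp, by linarith⟩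
    · obtain ⟨x, hx, rfl⟩ := Finset.mem_image.1 hp
      rw [hQP x hx]
      exact (hin x hx).1
  · rw [Finset.card_insert_of_notMem, Finset.card_image_of_injOn hinj]
    · exact Nat.lt_succ_self _
    · intro hmem
      obtain ⟨x, hx, hx'⟩ := Finset.mem_image.1 hmem
      have h1 := (hin x hx).2
      rw [← hQP x hx, hx'] at h1
      exact lt_irrefl _ h1

/-- An admissible triangle supports an irreducible polynomial vanishing to order `m` at `e`. -/
theorem exists_irreducible_vanishing [CharZero k] {m : ℕ} {n K : ℤ} (h : IsAdmissible m n K) :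
    ∃ f : LaurentRing k, Irreducible f ∧ VanishesToOrder f m ∧
      ∀ u ∈ f.coeff.support, InTriangle m n K u := by
  classical
  obtain ⟨T, hT, hcard⟩ := exists_finset_inTriangle h
  set J := (Finset.range m).sigma fun s => Finset.range (m - s) with hJ
  -- The binomial moments, that is, the Taylor coefficients at e of order less than m. There are
  -- more unknowns than equations, so the kernel is nonzero.
  let L : (T → k) →ₗ[k] (J → k) :=
    { toFun := fun c x => ∑ p : T, c p * ((p.1.1.choose x.1.1 : k) * (p.1.2.choose x.1.2 : k))
      map_add' := fun c d => by
        funext x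
        simp [add_mul, Finset.sum_add_distrib]
      map_smul' := fun r c => by
        funext x
        simp [Finset.mul_sum, mul_assoc] }
  have hker : LinearMap.ker L ≠ ⊥ := by
    apply LinearMap.ker_ne_bot_of_finrank_lt
    rw [Module.finrank_fintype_fun_eq_card, Module.finrank_fintype_fun_eq_card,
      Fintype.card_coe, Fintype.card_coe]
    exact hcard
  obtain ⟨c, hc, hc0⟩ := (Submodule.ne_bot_iff _).1 hker
  set c' : ℕ × ℕ → k := fun p => if hp : p ∈ T then c ⟨p, hp⟩ else 0 with hc'
  have hcc : ∀ p : T, c' p.1 = c p := fun p => by simp [hc']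
  set f : LaurentRing k := ∑ p ∈ T, single ((p.1 : ℤ), (p.2 : ℤ)) (c' p) with hf
  have hfm : f ∈ idealE k ^ m := by
    refine sum_single_mem_idealE_pow T c' fun i j hij => ?_
    have hx : (⟨i, j⟩ : (_ : ℕ) × ℕ) ∈ J := by
      simp only [hJ, Finset.mem_sigma, Finset.mem_range]
      omega
    have := congrFun (LinearMap.mem_ker.1 hc) ⟨⟨i, j⟩, hx⟩
    rw [← Finset.sum_coe_sort]
    simp only [hcc]
    exact this
  have hcoeff : ∀ u : ℤ × ℤ, f.coeff u =
      ∑ p ∈ T, if ((p.1 : ℤ), (p.2 : ℤ)) = u then c' p else 0 := by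
    intro u
    rw [hf, coeff_sum, Finsupp.finsetSum_apply]
    refine Finset.sum_congr rfl fun p _ => ?_
    rw [coeff_single, Finsupp.single_apply]
  have hsupp : ∀ u ∈ f.coeff.support, InTriangle m n K u := by
    intro u hu
    rw [Finsupp.mem_support_iff, hcoeff] at hu
    obtain ⟨p, hp, hpu⟩ := Finset.exists_ne_zero_of_sum_ne_zero hu
    have : ((p.1 : ℤ), (p.2 : ℤ)) = u := by
      by_contra hne
      exact hpu (if_neg hne)
    rw [← this]
    exact hT p hp
  have hf0 : f ≠ 0 := by
    intro h0
    apply hc0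
    funext q
    have h1 := hcoeff ((q.1.1 : ℤ), (q.1.2 : ℤ))
    rw [h0, coeff_zero, Finsupp.zero_apply, Finset.sum_eq_single q.1] at h1
    · rw [if_pos rfl, hcc] at h1
      exact h1.symm
    · intro p _ hpq
      refine if_neg fun he => hpq ?_
      simp only [Prod.mk.injEq, Nat.cast_inj] at he
      exact Prod.ext he.1 he.2
    · exact fun hq => absurd q.2 hq
  obtain ⟨h00, hmn⟩ := mem_support_of_admissible h hf0 hfm hsupp
  refine ⟨f, ?_, ⟨hfm, ?_⟩, hsupp⟩
  · refine irreducible_of_primitive_edge (by exact_mod_cast h.m_pos) h.coprime h00 hmn fun u hu => ?_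
    exact ⟨(hsupp u hu).fst_nonneg h, (hsupp u hu).fst_le h, (hsupp u hu).2.2,
      fun h0 => by rw [(hsupp u hu).eq_of_fst_eq_zero h h0]⟩
  · refine notMem_idealE_pow h00 fun u hu => ?_
    exact ⟨(hsupp u hu).fst_nonneg h, (hsupp u hu).fst_le h,
      (hsupp u hu).eq_of_fst_eq_zero h⟩

end Triangles

/-! ### Triangles as intersections of half-planes -/

section Regions

theorem newtonPolygon_subset_region_iff (f : LaurentRing k) (D : PlaneTriangle) :
    newtonPolygon f ⊆ D.region ↔
      ∀ u ∈ f.coeff.support, ((u.1 : ℝ), (u.2 : ℝ)) ∈ D.region := by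
  unfold newtonPolygon PlaneTriangle.region
  rw [(convex_convexHull ℝ _).convexHull_subset_iff, Set.image_subset_iff]
  rfl

theorem mem_convexHull_triangle_iff {m n K : ℤ} (hm : 0 < m) (hn : 0 < n) (hK : n < K * m)
    (u : ℤ × ℤ) :
    ((u.1 : ℝ), (u.2 : ℝ)) ∈ convexHull ℝ
      {((0 : ℝ), (0 : ℝ)), ((m : ℝ), (n : ℝ)), ((m : ℝ) - (n : ℝ) / K, (0 : ℝ))} ↔
      InTriangle m n K u := by
  have hKpos : 0 < K := pos_of_mul_pos_left (hn.trans hK) hm.le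
  have hm' : (0 : ℝ) < m := by exact_mod_cast hm
  have hn' : (0 : ℝ) < n := by exact_mod_cast hn
  have hK' : (0 : ℝ) < K := by exact_mod_cast hKpos
  have hlt : (0 : ℝ) < K * m - n := by
    have : (n : ℝ) < K * m := by exact_mod_cast hK
    linarith
  constructor
  · intro hu
    have hconv : Convex ℝ {z : ℝ × ℝ | 0 ≤ z.2 ∧ n + K * (z.1 - m) ≤ z.2 ∧ m * z.2 ≤ n * z.1} := by
      intro x hx y hy a b ha hb hab
      obtain ⟨x1, x2, x3⟩ := hx
      obtain ⟨y1, y2, y3⟩ := hy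
      have hb' : b = 1 - a := by linarith
      subst hb'
      simp only [Set.mem_ofPred_eq, Prod.fst_add, Prod.snd_add, Prod.smul_fst, Prod.smul_snd,
        smul_eq_mul]
      refine ⟨by positivity, ?_, ?_⟩
      · nlinarith [mul_le_mul_of_nonneg_left x2 ha, mul_le_mul_of_nonneg_left y2 hb]
      · nlinarith [mul_le_mul_of_nonneg_left x3 ha, mul_le_mul_of_nonneg_left y3 hb]
    have hsub := convexHull_min (s := {((0 : ℝ), (0 : ℝ)), ((m : ℝ), (n : ℝ)),
      ((m : ℝ) - (n : ℝ) / K, (0 : ℝ))}) ?_ hconv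
    · obtain ⟨h1, h2, h3⟩ := hsub hu
      simp only at h1 h2 h3
      exact ⟨by exact_mod_cast h1, by exact_mod_cast h2, by exact_mod_cast h3⟩
    · have e : (K : ℝ) * (n / K) = n := by field_simp
      rintro z (rfl | rfl | rfl)
      · refine ⟨le_rfl, ?_, by simp⟩
        simp only
        linarith
      · refine ⟨hn'.le, by simp, ?_⟩
        simp only
        linarith
      · refine ⟨le_rfl, ?_, ?_⟩
        · simp only
          linarith
        · simp only [mul_zero]
          have : (0 : ℝ) ≤ m - n / K := by
            rw [sub_nonneg, div_le_iff₀ hK']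
            linarith
          positivity
  · rintro ⟨h1, h2, h3⟩
    have h1' : (0 : ℝ) ≤ u.2 := by exact_mod_cast h1
    have h2' : (n : ℝ) + K * (u.1 - m) ≤ u.2 := by exact_mod_cast h2
    have h3' : (m : ℝ) * u.2 ≤ n * u.1 := by exact_mod_cast h3
    -- `α` and `β` are the barycentric weights of (m,n) and (m - n/K, 0).
    set α : ℝ := u.2 / n with hα
    set β : ℝ := K * (n * u.1 - m * u.2) / (n * (K * m - n)) with hβ
    have hα0 : 0 ≤ α := by positivity
    have hβ0 : 0 ≤ β := by
      have : (0 : ℝ) ≤ n * u.1 - m * u.2 := by linarith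
      positivity
    have hαβ : α + β ≤ 1 := by
      have : 1 - (α + β) = (u.2 - (n + K * (u.1 - m))) / (K * m - n) := by
        rw [hα, hβ]
        field_simp
        ring
      have h4 : (0 : ℝ) ≤ (u.2 - (n + K * (u.1 - m))) / (K * m - n) :=
        div_nonneg (by linarith) hlt.le
      linarith
    set S : Set (ℝ × ℝ) := {((0 : ℝ), (0 : ℝ)), ((m : ℝ), (n : ℝ)),
      ((m : ℝ) - (n : ℝ) / K, (0 : ℝ))} with hS
    have hc := convex_convexHull ℝ S
    have p0 : ((0 : ℝ), (0 : ℝ)) ∈ convexHull ℝ S := subset_convexHull ℝ S (by simp [hS])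
    have p1 : ((m : ℝ), (n : ℝ)) ∈ convexHull ℝ S := subset_convexHull ℝ S (by simp [hS])
    have p2 : ((m : ℝ) - (n : ℝ) / K, (0 : ℝ)) ∈ convexHull ℝ S :=
      subset_convexHull ℝ S (by simp [hS])
    have hsum := hc.sum_mem (t := Finset.univ) (w := ![1 - (α + β), α, β])
      (z := ![((0 : ℝ), (0 : ℝ)), ((m : ℝ), (n : ℝ)), ((m : ℝ) - (n : ℝ) / K, (0 : ℝ))])
      (by
        intro i _
        fin_cases i
        · simpa using hαβ
        · exact hα0
        · exact hβ0)
      (by simp [Fin.sum_univ_three]; ring)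
      (by
        intro i _
        fin_cases i
        · exact p0
        · exact p1
        · exact p2)
    convert hsum using 1
    simp only [Fin.sum_univ_three, Matrix.cons_val_zero, Matrix.cons_val_one, Matrix.cons_val]
    ext
    · simp only [Prod.fst_add, Prod.smul_fst, smul_eq_mul]
      rw [hα, hβ]
      field_simp
      ring
    · simp only [Prod.snd_add, Prod.smul_snd, smul_eq_mul]
      rw [hα, hβ]
      field_simp
      ring

end Regions

/-! ### Arithmetic of the integral and rational triangles -/

section Solutions

variable {M N K : ℕ}

theorem IsSolution.cast (h : IsSolution M N K) :
    (3 : ℤ) ≤ K ∧ ((M : ℤ) + N) ^ 2 = K * M * N + 1 := by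
  obtain ⟨h1, h2⟩ := h
  exact ⟨by exact_mod_cast h1, by exact_mod_cast h2⟩

/-- Here n(Km - n) = K²MN = Km² - K, so δ = K; the defining equation is itself a Bézout relation. -/
theorem IsSolution.isAdmissible_IT (h : IsSolution M N K) (hM : 0 < M) (hN : 0 < N) :
    IsAdmissible ((M + N : ℕ) : ℤ) (K * N) K := by
  obtain ⟨h1, h2⟩ := h.cast
  have hM' : (0 : ℤ) < M := by exact_mod_cast hM
  have hN' : (0 : ℤ) < N := by exact_mod_cast hN
  have hK' : (0 : ℤ) < K := by linarith
  push_cast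
  refine ⟨by positivity, by positivity, by nlinarith, ⟨M + N, -M, by linear_combination h2⟩,
    K, hK', le_rfl, by linear_combination (-(K : ℤ)) * h2⟩

/-- Here n(Km - n) = (M+N)(KM - M - N) = KM² - 1, so δ = 1. -/
theorem IsSolution.isAdmissible_RT (h : IsSolution M N K) (hM : 0 < M) :
    IsAdmissible M ((M : ℤ) + N) K := by
  obtain ⟨h1, h2⟩ := h.cast
  have hM' : (0 : ℤ) < M := by exact_mod_cast hM
  have hN' : (0 : ℤ) ≤ N := by positivity
  have hn : (0 : ℤ) < M + N := by linarith
  have e : ((M : ℤ) + N) * (K * M - (M + N)) = K * M ^ 2 - 1 := by linear_combination -h2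
  refine ⟨hM', hn, ?_, ⟨-(K * N), M + N, by linear_combination h2⟩, 1, one_pos, by linarith, e⟩
  have : 0 < ((M : ℤ) + N) * (K * M - (M + N)) := by rw [e]; nlinarith
  linarith [pos_of_mul_pos_right this hn.le]

theorem mem_region_IT_iff (h : IsSolution M N K) (hM : 0 < M) (hN : 0 < N) (u : ℤ × ℤ) :
    ((u.1 : ℝ), (u.2 : ℝ)) ∈ (IT M N K).region ↔
      InTriangle ((M + N : ℕ) : ℤ) (K * N) K u := by
  have ha := h.isAdmissible_IT hM hN
  rw [← mem_convexHull_triangle_iff ha.m_pos ha.n_pos ha.n_lt]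
  have hK : (K : ℝ) ≠ 0 := by
    have := h.1
    exact_mod_cast (by omega : K ≠ 0)
  have e : (((M + N : ℕ) : ℤ) : ℝ) - ((K * N : ℤ) : ℝ) / ((K : ℤ) : ℝ) = M := by
    push_cast
    field_simp
    ring
  rw [e]
  simp only [PlaneTriangle.region, IT]
  push_cast
  rfl

theorem mem_region_RT_iff (h : IsSolution M N K) (hM : 0 < M) (u : ℤ × ℤ) :
    ((u.1 : ℝ), (u.2 : ℝ)) ∈ (RT M N K).region ↔ InTriangle M ((M : ℤ) + N) K u := by
  have ha := h.isAdmissible_RT hM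
  rw [← mem_convexHull_triangle_iff ha.m_pos ha.n_pos ha.n_lt]
  simp only [PlaneTriangle.region, RT]
  push_cast
  rfl

theorem area_IT (h : IsSolution M N K) : (IT M N K).area = (((M : ℝ) + N) ^ 2 - 1) / 2 := by
  have h2 : ((M : ℝ) + N) ^ 2 = K * M * N + 1 := by exact_mod_cast h.2
  have e : ((M : ℝ) + N - 0) * (0 - 0) - ((M : ℝ) - 0) * ((K : ℝ) * N - 0) =
      -((K : ℝ) * M * N) := by ring
  simp only [PlaneTriangle.area, IT]
  rw [e, abs_neg, abs_of_nonneg (by positivity), h2]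
  ring

theorem area_RT (h : IsSolution M N K) (hM : 0 < M) :
    (RT M N K).area = ((M : ℝ) ^ 2 - 1 / K) / 2 := by
  have h2 : ((M : ℝ) + N) ^ 2 = K * M * N + 1 := by exact_mod_cast h.2
  have hK3 : (3 : ℝ) ≤ K := by exact_mod_cast h.1
  have hM1 : (1 : ℝ) ≤ M := by exact_mod_cast hM
  have hK : (K : ℝ) ≠ 0 := by linarith
  have e : ((M : ℝ) - 0) * (0 - 0) - ((M : ℝ) - ((M : ℝ) + N) / K - 0) * ((M : ℝ) + N - 0) =
      -((M : ℝ) ^ 2 - 1 / K) := by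
    field_simp
    linear_combination h2
  simp only [PlaneTriangle.area, RT]
  rw [e, abs_neg, abs_of_nonneg]
  have : 1 / (K : ℝ) ≤ 1 := by
    rw [div_le_one (by linarith)]
    linarith
  nlinarith

theorem IsSolution.eq_one_of_right (h : IsSolution M 0 K) : M = 1 := by
  have := h.2
  simpa using this

theorem IsSolution.eq_one_of_left (h : IsSolution 0 N K) : N = 1 := by
  have := h.2
  simpa using this

end Solutions

/-! ### Existence of the negative curves -/

section Existence

/-- The binomial `x y^n - 1` defines a negative curve of order one. -/
theorem exists_definesNegativeCurve_one [CharZero k] (n : ℕ) :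
    ∃ f : LaurentRing k, DefinesNegativeCurve f 1 ∧
      ∀ u ∈ f.coeff.support, u = (0, 0) ∨ u = (1, (n : ℤ)) := by
  classical
  set f : LaurentRing k := single (1, (n : ℤ)) 1 - single (0, 0) 1 with hf
  have hne : ((1, (n : ℤ)) : ℤ × ℤ) ≠ (0, 0) := by simp
  have hcoeff : ∀ u : ℤ × ℤ, f.coeff u =
      (if (1, (n : ℤ)) = u then 1 else 0) - (if (0, 0) = u then 1 else 0) := by
    intro u
    rw [hf, coeff_sub, Finsupp.sub_apply, coeff_single, coeff_single, Finsupp.single_apply,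
      Finsupp.single_apply]
  have h0 : (0, 0) ∈ f.coeff.support := by
    rw [Finsupp.mem_support_iff, hcoeff, if_neg hne, if_pos rfl]
    simp
  have h1 : (((1 : ℕ) : ℤ), (n : ℤ)) ∈ f.coeff.support := by
    rw [Nat.cast_one, Finsupp.mem_support_iff, hcoeff, if_neg hne.symm, if_pos rfl]
    simp
  have hsupp : ∀ u ∈ f.coeff.support, u = (0, 0) ∨ u = (1, (n : ℤ)) := by
    intro u hu
    by_contra! hcon
    rw [Finsupp.mem_support_iff, hcoeff, if_neg hcon.2.symm, if_neg hcon.1.symm] at hu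
    simp at hu
  have hmem : f ∈ idealE k ^ 1 := by
    have := sum_single_mem_idealE_pow (k := k) (m := 1) {(1, n), (0, 0)}
      (fun p => if p = (0, 0) then -1 else 1) (by
        intro i j hij
        obtain ⟨rfl, rfl⟩ : i = 0 ∧ j = 0 := by omega
        rw [Finset.sum_pair (by simp)]
        simp)
    rw [Finset.sum_pair (by simp)] at this
    convert this using 1
    simp [hf, single_neg, sub_eq_add_neg]
  refine ⟨f, ⟨?_, ⟨hmem, ?_⟩, ⟨(0, 0), (1, n), (0, 1)⟩, ?_, ?_, ?_⟩, hsupp⟩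
  · refine irreducible_of_primitive_edge one_pos (by simp [isCoprime_one_left]) h0 h1 ?_
    intro u hu
    rcases hsupp u hu with rfl | rfl <;> simp
  · refine notMem_idealE_pow h0 ?_
    intro u hu
    rcases hsupp u hu with rfl | rfl <;> simp
  · simp [PlaneTriangle.area]
  · simp [PlaneTriangle.area]
  · rw [newtonPolygon_subset_region_iff]
    intro u hu
    refine subset_convexHull ℝ _ ?_
    rcases hsupp u hu with rfl | rfl <;> simp

/-- If M N = 0, the other number is 1 and the triangle is a segment from (0,0) to (1,K) or (1,0),
which carries a binomial; its nondegenerate triangle has to be a different one. -/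
theorem exists_supportsNegativeCurve_IT [CharZero k] {M N K : ℕ} (h : IsSolution M N K) :
    ∃ f : LaurentRing k, SupportsNegativeCurve (IT M N K) (M + N) f := by
  have harea : (IT M N K).area ≤ ((M + N : ℕ) : ℝ) ^ 2 / 2 := by
    rw [area_IT h]
    push_cast
    linarith
  rcases Nat.eq_zero_or_pos M with rfl | hM
  · obtain rfl := h.eq_one_of_left
    obtain ⟨f, hf, hsupp⟩ := exists_definesNegativeCurve_one (k := k) K
    refine ⟨f, harea, ?_, hf⟩
    rw [newtonPolygon_subset_region_iff]
    intro u hu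
    refine subset_convexHull ℝ _ ?_
    rcases hsupp u hu with rfl | rfl <;> simp [IT]
  rcases Nat.eq_zero_or_pos N with rfl | hN
  · obtain rfl := h.eq_one_of_right
    obtain ⟨f, hf, hsupp⟩ := exists_definesNegativeCurve_one (k := k) 0
    refine ⟨f, harea, ?_, hf⟩
    rw [newtonPolygon_subset_region_iff]
    intro u hu
    refine subset_convexHull ℝ _ ?_
    rcases hsupp u hu with rfl | rfl <;> simp [IT]
  obtain ⟨f, hirr, hord, hsupp⟩ := exists_irreducible_vanishing (k := k) (h.isAdmissible_IT hM hN)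
  have hN : newtonPolygon f ⊆ (IT M N K).region := by
    rw [newtonPolygon_subset_region_iff]
    exact fun u hu => (mem_region_IT_iff h hM hN u).2 (hsupp u hu)
  refine ⟨f, harea, hN, hirr, hord, _, ?_, harea, hN⟩
  rw [area_IT h]
  have : (1 : ℝ) ≤ M := by exact_mod_cast hM
  have : (1 : ℝ) ≤ N := by exact_mod_cast (by assumption : 0 < N)
  nlinarith

theorem exists_supportsNegativeCurve_RT [CharZero k] {M N K : ℕ} (h : IsSolution M N K)
    (hM : 0 < M) : ∃ f : LaurentRing k, SupportsNegativeCurve (RT M N K) M f := by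
  have hK3 : (3 : ℝ) ≤ K := by exact_mod_cast h.1
  have hM1 : (1 : ℝ) ≤ M := by exact_mod_cast hM
  have hK0 : 0 < 1 / (K : ℝ) := by positivity
  have hK1 : 1 / (K : ℝ) < 1 := by
    rw [div_lt_one (by linarith)]
    linarith
  have harea : (RT M N K).area ≤ (M : ℝ) ^ 2 / 2 := by
    rw [area_RT h hM]
    linarith
  obtain ⟨f, hirr, hord, hsupp⟩ := exists_irreducible_vanishing (k := k) (h.isAdmissible_RT hM)
  have hN : newtonPolygon f ⊆ (RT M N K).region := by
    rw [newtonPolygon_subset_region_iff]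
    exact fun u hu => (mem_region_RT_iff h hM u).2 (hsupp u hu)
  refine ⟨f, harea, hN, hirr, hord, _, ?_, harea, hN⟩
  rw [area_RT h hM]
  nlinarith

end Existence

/-! ### Classification of lattice isomorphisms between supports -/

section Comparison

/-- The properties of the support of a negative curve in an admissible triangle with vertices
`(0, 0)`, `(m, m + r)` and `(m - (m + r) / K, 0)` that are used to distinguish such curves. -/
structure IsNegativeSupport (S : Set (ℤ × ℤ)) (m r K : ℤ) : Prop where
  two_le : 2 ≤ m
  r_pos : 0 < r
  r_lt : r < m
  three_le : 3 ≤ K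
  admissible : IsAdmissible m (m + r) K
  zero_mem : (0, 0) ∈ S
  end_mem : (m, m + r) ∈ S
  inTriangle : ∀ u ∈ S, InTriangle m (m + r) K u
  width : ∀ a b : ℤ, IsCoprime a b → ∃ u ∈ S, ∃ v ∈ S,
    (a * u.1 + b * u.2) + m ≤ a * v.1 + b * v.2

/-- The affine map `(x, y) ↦ (a x + b y + d₁, c x + e y + d₂)` of determinant `ε = ± 1` identifies
`S` with `S'`. -/
structure IsLatticeIso (S S' : Set (ℤ × ℤ)) (a b c e d₁ d₂ ε : ℤ) : Prop where
  sign : ε = 1 ∨ ε = -1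
  det : a * e - b * c = ε
  mem_iff : ∀ x y : ℤ, (x, y) ∈ S ↔ (a * x + b * y + d₁, c * x + e * y + d₂) ∈ S'

variable {S S' : Set (ℤ × ℤ)} {m r K m' r' K' a b c e d₁ d₂ ε : ℤ}

theorem IsLatticeIso.symm (h : IsLatticeIso S S' a b c e d₁ d₂ ε) :
    IsLatticeIso S' S (ε * e) (-(ε * b)) (-(ε * c)) (ε * a) (ε * (b * d₂ - e * d₁))
      (ε * (c * d₁ - a * d₂)) ε := by
  have hε : ε * ε = 1 := by rcases h.sign with h | h <;> rw [h] <;> norm_num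
  refine ⟨h.sign, by linear_combination (a * e - b * c) * hε + h.det, fun x y => ?_⟩
  rw [h.mem_iff]
  have e1 : a * (ε * e * x + -(ε * b) * y + ε * (b * d₂ - e * d₁)) +
      b * (-(ε * c) * x + ε * a * y + ε * (c * d₁ - a * d₂)) + d₁ = x := by
    linear_combination (ε * (x - d₁)) * h.det + (x - d₁) * hε
  have e2 : c * (ε * e * x + -(ε * b) * y + ε * (b * d₂ - e * d₁)) +
      e * (-(ε * c) * x + ε * a * y + ε * (c * d₁ - a * d₂)) + d₂ = y := by
    linear_combination (ε * (y - d₂)) * h.det + (y - d₂) * hε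
  rw [e1, e2]

theorem IsLatticeIso.isCoprime (h : IsLatticeIso S S' a b c e d₁ d₂ ε) : IsCoprime a b := by
  have hε : ε * ε = 1 := by rcases h.sign with h | h <;> rw [h] <;> norm_num
  exact ⟨ε * e, -(ε * c), by linear_combination ε * h.det + hε⟩

/-- The first coordinate of `S'` pulls back to a functional whose width on `S` is at least m, while
`S'` lies in the columns 0, ..., m'. -/
theorem IsLatticeIso.order_le (h : IsLatticeIso S S' a b c e d₁ d₂ ε)
    (hS : IsNegativeSupport S m r K) (hS' : IsNegativeSupport S' m' r' K') : m ≤ m' := by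
  obtain ⟨u, hu, v, hv, huv⟩ := hS.width a b h.isCoprime
  have hu' := (hS'.inTriangle _ ((h.mem_iff u.1 u.2).1 hu)).fst_nonneg hS'.admissible
  have hv' := (hS'.inTriangle _ ((h.mem_iff v.1 v.2).1 hv)).fst_le hS'.admissible
  simp only at hu' hv'
  linarith

theorem IsLatticeIso.order_eq (h : IsLatticeIso S S' a b c e d₁ d₂ ε)
    (hS : IsNegativeSupport S m r K) (hS' : IsNegativeSupport S' m' r' K') : m = m' :=
  le_antisymm (h.order_le hS hS') (h.symm.order_le hS' hS)

/-- A lattice isomorphism pulls back the first coordinate to a functional whose second coefficient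
is at most one in absolute value. -/
theorem IsLatticeIso.abs_le_one (h : IsLatticeIso S S' a b c e d₁ d₂ ε)
    (hS : IsNegativeSupport S m r K) (hS' : IsNegativeSupport S' m r' K') :
    b = 0 ∨ b = 1 ∨ b = -1 := by
  have hm := hS.two_le
  have hx : ∀ u ∈ S, 0 ≤ u.1 ∧ u.1 ≤ m := fun u hu =>
    ⟨(hS.inTriangle u hu).fst_nonneg hS.admissible, (hS.inTriangle u hu).fst_le hS.admissible⟩
  have hx' : ∀ u ∈ S, 0 ≤ a * u.1 + b * u.2 + d₁ ∧ a * u.1 + b * u.2 + d₁ ≤ m := fun u hu =>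
    ⟨(hS'.inTriangle _ ((h.mem_iff u.1 u.2).1 hu)).fst_nonneg hS'.admissible,
      (hS'.inTriangle _ ((h.mem_iff u.1 u.2).1 hu)).fst_le hS'.admissible⟩
  -- Take two points of `S` at distance `D` ≥ m in direction (g,1). With `X` the difference of their
  -- first coordinates, the pulled-back coordinate differs by `W` = bD + lX. Since |X| and |W| are
  -- at most m, this gives |b| ≤ 1 + |l|; extreme values of `X` can only come from the two end
  -- vertices.
  have key : ∀ l g : ℤ, a = l + b * g → ∃ D X W : ℤ, m ≤ D ∧ W = b * D + l * X ∧ |X| ≤ m ∧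
      |W| ≤ m ∧ (X = m → W = a * m + b * (m + r)) ∧ (X = -m → W = -(a * m + b * (m + r))) := by
    intro l g hl
    obtain ⟨u, hu, v, hv, huv⟩ := hS.width g 1 isCoprime_one_right
    refine ⟨g * (v.1 - u.1) + (v.2 - u.2), v.1 - u.1, a * (v.1 - u.1) + b * (v.2 - u.2),
      by linarith, by rw [hl]; ring, abs_le.2 ?_, abs_le.2 ?_, fun hX => ?_, fun hX => ?_⟩
    · have := hx u hu; have := hx v hv; constructor <;> linarith
    · have := hx' u hu; have := hx' v hv; constructor <;> linarith
    · have h1 := hx u hu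
      have h2 := hx v hv
      have e1 := (hS.inTriangle u hu).eq_of_fst_eq_zero hS.admissible (by linarith)
      have e2 := (hS.inTriangle v hv).eq_of_fst_eq hS.admissible (by linarith)
      rw [e1, e2]
      ring
    · have h1 := hx u hu
      have h2 := hx v hv
      have e1 := (hS.inTriangle v hv).eq_of_fst_eq_zero hS.admissible (by linarith)
      have e2 := (hS.inTriangle u hu).eq_of_fst_eq hS.admissible (by linarith)
      rw [e1, e2]
      ring
  by_contra! hb
  obtain ⟨hb0, hb1, hb2⟩ := hb
  have hbabs : 2 ≤ |b| := by
    rcases abs_cases b with ⟨h1, h2⟩ | ⟨h1, h2⟩ <;> omega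
  have hest : ∀ l D X W : ℤ, m ≤ D → W = b * D + l * X → |X| ≤ m → |W| ≤ m →
      |b| * m ≤ m + |l| * m := by
    intro l D X W hD hW hX hWm
    have h1 : |b| * D ≤ |W| + |l| * |X| := by
      have : b * D = W - l * X := by linarith
      calc |b| * D = |b * D| := by rw [abs_mul, abs_of_nonneg (by linarith : 0 ≤ D)]
        _ = |W - l * X| := by rw [this]
        _ ≤ |W| + |l * X| := abs_sub _ _
        _ = |W| + |l| * |X| := by rw [abs_mul]
    have h2 : |l| * |X| ≤ |l| * m := mul_le_mul_of_nonneg_left hX (abs_nonneg l)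
    have h3 : |b| * m ≤ |b| * D := mul_le_mul_of_nonneg_left hD (abs_nonneg b)
    linarith
  have hb2 : |b| = 2 := by
    -- The residue of a modulo b of least absolute value; |l| ≤ |b|/2 then gives |b| ≤ 2.
    obtain ⟨l, g, hl, hlb⟩ : ∃ l g : ℤ, a = l + b * g ∧ 2 * |l| ≤ |b| := by
      have h1 := Int.emod_add_mul_ediv a b
      have h2 := Int.emod_nonneg a hb0
      have h3 := Int.emod_lt_abs a hb0
      by_cases hle : 2 * (a % b) ≤ |b|
      · exact ⟨a % b, a / b, h1.symm, by rwa [abs_of_nonneg h2]⟩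
      · rcases abs_cases b with ⟨hb, -⟩ | ⟨hb, -⟩
        · refine ⟨a % b - b, a / b + 1, by linarith, ?_⟩
          rw [abs_of_nonpos (by linarith)]
          linarith
        · refine ⟨a % b + b, a / b - 1, by linarith, ?_⟩
          rw [abs_of_nonpos (by linarith)]
          linarith
    obtain ⟨D, X, W, hD, hW, hX, hWm, -, -⟩ := key l g hl
    have := hest l D X W hD hW hX hWm
    nlinarith
  have hodd : ∃ g : ℤ, a = 1 + b * g := by
    rcases Int.even_or_odd a with ⟨j, hj⟩ | ⟨j, hj⟩
    · exfalso
      have h2a : (2 : ℤ) ∣ a := ⟨j, by linarith⟩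
      have h2b : (2 : ℤ) ∣ b := by rw [← dvd_abs, hb2]
      have := h.isCoprime.isUnit_of_dvd' h2a h2b
      exact absurd (Int.isUnit_iff.1 this) (by norm_num)
    · rcases abs_cases b with ⟨hb, -⟩ | ⟨hb, -⟩
      · exact ⟨j, by rw [show b = 2 by linarith]; linarith⟩
      · exact ⟨-j, by rw [show b = -2 by linarith]; linarith⟩
  obtain ⟨g, hg⟩ := hodd
  have hb' : b = 2 ∨ b = -2 := by
    rcases abs_cases b with ⟨hb, -⟩ | ⟨hb, -⟩ <;> omega
  -- For |b| = 2 the residues 1 and -1 both make the estimate sharp. They require the same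
  -- end-to-end difference am + b(m + r) to be m and -m at once.
  rcases hb' with rfl | rfl
  · obtain ⟨D, X, W, hD, hW, hX, hWm, -, h2⟩ := key 1 g hg
    obtain ⟨D', X', W', hD', hW', hX', hWm', h1', -⟩ := key (-1) (g + 1) (by linarith)
    rw [abs_le] at hX hWm hX' hWm'
    have := h2 (by linarith)
    have := h1' (by linarith)
    linarith
  · obtain ⟨D, X, W, hD, hW, hX, hWm, h1, -⟩ := key 1 g hg
    obtain ⟨D', X', W', hD', hW', hX', hWm', -, h2'⟩ := key (-1) (g - 1) (by linarith)
    rw [abs_le] at hX hWm hX' hWm'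
    have := h1 (by linarith)
    have := h2' (by linarith)
    linarith

theorem eq_of_mul_add {m p q t : ℤ} (hp : 0 < p) (hpm : p < m) (hq : 0 < q) (hqm : q < m)
    (h : p = q + t * m) : p = q := by
  have ht : t = 0 := by
    have h1 : t < 1 := by by_contra hlt; push Not at hlt; nlinarith
    have h2 : -1 < t := by by_contra hlt; push Not at hlt; nlinarith
    omega
  rw [h, ht]
  ring

/-- The possibilities for a lattice isomorphism that preserves the vertical direction. -/
theorem IsLatticeIso.vertical (h : IsLatticeIso S S' a 0 c e d₁ d₂ ε)
    (hS : IsNegativeSupport S m r K) (hS' : IsNegativeSupport S' m r' K') :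
    (r' = r ∨ r' = m - r) ∧ ∀ u ∈ S, ∃ u' ∈ S', (u'.1 = u.1 ∨ u'.1 = m - u.1) ∧
      (m + r') * u'.1 - m * u'.2 = (m + r) * u.1 - m * u.2 := by
  have hm := hS.two_le
  have hr := hS.r_pos
  have hrm := hS.r_lt
  have hr' := hS'.r_pos
  have hrm' := hS'.r_lt
  have hdet := h.det
  rw [zero_mul, sub_zero] at hdet
  have hu : IsUnit (a * e) := by rw [hdet]; exact Int.isUnit_iff.2 h.sign
  have ha := Int.isUnit_iff.1 (isUnit_of_mul_isUnit_left hu)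
  have he := Int.isUnit_iff.1 (isUnit_of_mul_isUnit_right hu)
  have z := (h.mem_iff _ _).1 hS.zero_mem
  have w := (h.mem_iff _ _).1 hS.end_mem
  have zT := hS'.inTriangle _ z
  have wT := hS'.inTriangle _ w
  have z0 := zT.fst_nonneg hS'.admissible
  have zm := zT.fst_le hS'.admissible
  have w0 := wT.fst_nonneg hS'.admissible
  have wm := wT.fst_le hS'.admissible
  simp only [mul_zero, zero_mul, add_zero, zero_add] at z0 zm w0 wm
  -- The depth (m + r)x - my below the long edge is nonnegative on both supports. If the map negates
  -- it, both depths vanish, so it is preserved in either case.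
  have hdepth : ∀ u ∈ S, (m + r') * (a * u.1 + 0 * u.2 + d₁) - m * (c * u.1 + e * u.2 + d₂) =
      e * ((m + r) * u.1 - m * u.2) → (m + r') * (a * u.1 + 0 * u.2 + d₁) -
      m * (c * u.1 + e * u.2 + d₂) = (m + r) * u.1 - m * u.2 := by
    intro u hu hd
    have h1 := (hS.inTriangle u hu).2.2
    have h2 := (hS'.inTriangle _ ((h.mem_iff u.1 u.2).1 hu)).2.2
    simp only at h2
    rcases he with rfl | rfl
    · linarith
    · linarith
  rcases ha with rfl | rfl
  · have hd₁ : d₁ = 0 := by linarith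
    subst hd₁
    have e1 := zT.eq_of_fst_eq_zero hS'.admissible (by simp)
    have e2 := wT.eq_of_fst_eq hS'.admissible (by simp)
    simp only [mul_zero, add_zero, zero_add, Prod.mk.injEq] at e1 e2
    have hd₂ : d₂ = 0 := e1.2
    subst hd₂
    have hn := e2.2
    refine ⟨?_, fun u hu => ⟨_, (h.mem_iff u.1 u.2).1 hu, Or.inl (by simp), ?_⟩⟩
    · rcases he with rfl | rfl
      · left
        exact eq_of_mul_add hr' hrm' hr hrm (t := c) (by linarith)
      · right
        exact eq_of_mul_add hr' hrm' (by linarith) (by linarith) (t := c - 3) (by linarith)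
    · refine hdepth u hu ?_
      linear_combination (-u.1) * hn
  · have hd₁ : d₁ = m := by linarith
    subst hd₁
    have e1 := zT.eq_of_fst_eq hS'.admissible (by simp)
    have e2 := wT.eq_of_fst_eq_zero hS'.admissible (by simp)
    simp only [mul_zero, zero_add, Prod.mk.injEq] at e1 e2
    have hd₂ := e1.2
    have hn := e2.2
    refine ⟨?_, fun u hu => ⟨_, (h.mem_iff u.1 u.2).1 hu, Or.inr (by ring), ?_⟩⟩
    · rcases he with rfl | rfl
      · right
        exact eq_of_mul_add hr' hrm' (by linarith) (by linarith) (t := -c - 3) (by linarith)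
      · left
        exact eq_of_mul_add hr' hrm' hr hrm (t := -c) (by linarith)
    · refine hdepth u hu ?_
      linear_combination (u.1 - d₁) * hd₂ - u.1 * hn

/-- The possibilities for a lattice isomorphism that does not preserve the vertical direction, when
the first coordinate pulls back to `± (y - x)`. -/
theorem IsLatticeIso.slanted_one {s : ℤ} (h : IsLatticeIso S S' (-s) s c e d₁ d₂ ε)
    (hs : s = 1 ∨ s = -1)
    (hS : IsNegativeSupport S m r K) (hS' : IsNegativeSupport S' m r' K') :
    (s = 1 ∧ ε = -1 ∧ r' ≤ r) ∨
      (s = -1 ∧ ε = 1 ∧ m ≤ r + r' ∧ m ≤ (K - 1) * (m - r') ∧ r ≤ (K - 2) * (m - r)) := by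
  have hm := hS.two_le
  have hr := hS.r_pos
  have hrm := hS.r_lt
  have hr' := hS'.r_pos
  have hrm' := hS'.r_lt
  have hK := hS.three_le
  -- On `S`, y - x attains its bound r only at (m, m + r), so this vertex is the preimage of an end
  -- of the other triangle. The inequalities come from placing the preimage of the other end.
  have hle : ∀ u ∈ S, u.2 - u.1 ≤ r ∧ (u.2 - u.1 = r → u = (m, m + r)) := by
    intro u hu
    have h1 := (hS.inTriangle u hu).2.2
    have h2 := (hS.inTriangle u hu).fst_le hS.admissible
    constructor
    · by_contra hlt
      push Not at hlt
      nlinarith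
    · intro he
      refine (hS.inTriangle u hu).eq_of_fst_eq hS.admissible (le_antisymm h2 ?_)
      by_contra hlt
      push Not at hlt
      nlinarith
  have hrange : ∀ u ∈ S, 0 ≤ -s * u.1 + s * u.2 + d₁ ∧ -s * u.1 + s * u.2 + d₁ ≤ m := fun u hu =>
    ⟨(hS'.inTriangle _ ((h.mem_iff u.1 u.2).1 hu)).fst_nonneg hS'.admissible,
      (hS'.inTriangle _ ((h.mem_iff u.1 u.2).1 hu)).fst_le hS'.admissible⟩
  have hdepth : ∀ u ∈ S, m * (c * u.1 + e * u.2 + d₂) ≤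
      (m + r') * (-s * u.1 + s * u.2 + d₁) := fun u hu =>
    (hS'.inTriangle _ ((h.mem_iff u.1 u.2).1 hu)).2.2
  obtain ⟨E₀, hE₀, f1, f2⟩ : ∃ u ∈ S, -s * u.1 + s * u.2 + d₁ = 0 ∧ c * u.1 + e * u.2 + d₂ = 0 := by
    have h0 := hS'.zero_mem
    have h1 := (h.symm.mem_iff 0 0).1 h0
    refine ⟨_, h1, ?_⟩
    have h2 := (h.mem_iff _ _).1 h1
    have hε : ε * ε = 1 := by rcases h.sign with h | h <;> rw [h] <;> norm_num
    constructor
    · linear_combination (-ε * d₁) * h.det - d₁ * hε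
    · linear_combination (-ε * d₂) * h.det - d₂ * hε
  obtain ⟨E₁, hE₁, g1, g2⟩ : ∃ u ∈ S, -s * u.1 + s * u.2 + d₁ = m ∧
      c * u.1 + e * u.2 + d₂ = m + r' := by
    have h0 := hS'.end_mem
    have h1 := (h.symm.mem_iff _ _).1 h0
    refine ⟨_, h1, ?_⟩
    have hε : ε * ε = 1 := by rcases h.sign with h | h <;> rw [h] <;> norm_num
    constructor
    · linear_combination (ε * (m - d₁)) * h.det + (m - d₁) * hε
    · linear_combination (ε * (m + r' - d₂)) * h.det + (m + r' - d₂) * hε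
  have dz := hdepth _ hS.zero_mem
  have rw' := hrange _ hS.end_mem
  simp only [mul_zero, zero_add] at dz rw'
  have hdet := h.det
  rcases hs with rfl | rfl
  · left
    have hE₁' := (hle E₁ hE₁).2 (le_antisymm (hle E₁ hE₁).1 (by linarith))
    have hc : c = -e - ε := by linarith
    subst hc
    have hQ := hS.inTriangle E₀ hE₀
    obtain ⟨q, y⟩ := E₀
    subst hE₁'
    simp only at f1 f2 g1 g2
    obtain ⟨q1, q2, q3⟩ := hQ
    simp only at q1 q2 q3
    have hy : y = q + r - m := by linarith
    subst hy
    have hd₁ : d₁ = m - r := by linarith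
    subst hd₁
    have hd₂ : d₂ = ε * q + e * (m - r) := by linarith
    subst hd₂
    have hqm : q < m := by
      by_contra hlt
      push Not at hlt
      nlinarith
    have hn : m + r' = -ε * (m - q) + e * m := by linarith
    have hε : ε = -1 := by
      rcases h.sign with hε | hε
      · exfalso
        subst hε
        rw [hn] at dz
        nlinarith [mul_pos (sub_pos.2 hqm) (sub_pos.2 hrm)]
      · exact hε
    subst hε
    have : r' = m - q := eq_of_mul_add hr' hrm' (by linarith) (by linarith) (t := e - 1)
      (by linarith)
    exact ⟨rfl, rfl, by linarith⟩
  · right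
    have hE₀' := (hle E₀ hE₀).2 (le_antisymm (hle E₀ hE₀).1 (by linarith))
    have hc : c = -e + ε := by linarith
    subst hc
    have hQ := hS.inTriangle E₁ hE₁
    obtain ⟨q, y⟩ := E₁
    subst hE₀'
    simp only at f1 f2 g1 g2
    obtain ⟨q1, q2, q3⟩ := hQ
    simp only at q1 q2 q3
    have hd₁ : d₁ = r := by linarith
    subst hd₁
    have hy : y = q + d₁ - m := by linarith
    subst hy
    have hd₂ : d₂ = -ε * m - e * d₁ := by linarith
    subst hd₂
    have hqm : q < m := by
      by_contra hlt
      push Not at hlt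
      nlinarith
    have hn : m + r' = ε * (q - m) - e * m := by linarith
    have hε : ε = 1 := by
      rcases h.sign with hε | hε
      · exact hε
      · exfalso
        subst hε
        rw [hn] at dz
        nlinarith
    subst hε
    have hq : r' = q := eq_of_mul_add hr' hrm' (by linarith) (by linarith) (t := -e - 2)
      (by linarith)
    subst hq
    refine ⟨rfl, rfl, by linarith, by linarith, ?_⟩
    -- The functional 2x - y is nonnegative on `S` because the edge has slope less than 2. Hence
    -- some point has 2x - y ≥ m, and the right side of slope K restricts where it can be.
    obtain ⟨u, hu, v, hv, huv⟩ := hS.width 2 (-1) (isCoprime_one_right.neg_right)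
    have hu0 : 0 ≤ 2 * u.1 - u.2 := by
      have h1 := (hS.inTriangle u hu).2.2
      have h2 := (hS.inTriangle u hu).fst_nonneg hS.admissible
      by_contra hlt
      push Not at hlt
      nlinarith
    have hv1 := (hrange v hv).2
    have hv2 := (hS.inTriangle v hv).2.1
    have hvr : d₁ ≤ v.1 := by linarith
    nlinarith

/-- The possibilities for a lattice isomorphism that does not preserve the vertical direction, when
the first coordinate pulls back to `± (y - 2x)`. -/
theorem IsLatticeIso.slanted_two {s : ℤ} (h : IsLatticeIso S S' (-(2 * s)) s c e d₁ d₂ ε)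
    (hs : s = 1 ∨ s = -1)
    (hS : IsNegativeSupport S m r K) (hS' : IsNegativeSupport S' m r' K') :
    (s = 1 ∧ ε = 1 ∧ m ≤ 2 * r ∧ m ≤ 2 * r' ∧ r ≤ (K - 2) * (m - r')) ∨
      (s = -1 ∧ ε = -1 ∧ m ≤ 2 * r ∧ 2 * r' ≤ m) := by
  have hm := hS.two_le
  have hr := hS.r_pos
  have hrm := hS.r_lt
  have hr' := hS'.r_pos
  have hrm' := hS'.r_lt
  have hK := hS.three_le
  -- As the edge has slope less than 2, y - 2x attains its bound 0 only at the origin, which is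
  -- therefore the preimage of an end.
  have hle : ∀ u ∈ S, u.2 - 2 * u.1 ≤ 0 ∧ (u.2 - 2 * u.1 = 0 → u = (0, 0)) := by
    intro u hu
    have h1 := (hS.inTriangle u hu).2.2
    have h2 := (hS.inTriangle u hu).fst_nonneg hS.admissible
    constructor
    · by_contra hlt
      push Not at hlt
      nlinarith
    · intro he
      refine (hS.inTriangle u hu).eq_of_fst_eq_zero hS.admissible (le_antisymm ?_ h2)
      by_contra hlt
      push Not at hlt
      nlinarith
  have hrange : ∀ u ∈ S, 0 ≤ -(2 * s) * u.1 + s * u.2 + d₁ ∧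
      -(2 * s) * u.1 + s * u.2 + d₁ ≤ m := fun u hu =>
    ⟨(hS'.inTriangle _ ((h.mem_iff u.1 u.2).1 hu)).fst_nonneg hS'.admissible,
      (hS'.inTriangle _ ((h.mem_iff u.1 u.2).1 hu)).fst_le hS'.admissible⟩
  have hdepth : ∀ u ∈ S, m * (c * u.1 + e * u.2 + d₂) ≤
      (m + r') * (-(2 * s) * u.1 + s * u.2 + d₁) := fun u hu =>
    (hS'.inTriangle _ ((h.mem_iff u.1 u.2).1 hu)).2.2
  obtain ⟨E₀, hE₀, f1, f2⟩ : ∃ u ∈ S, -(2 * s) * u.1 + s * u.2 + d₁ = 0 ∧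
      c * u.1 + e * u.2 + d₂ = 0 := by
    have h0 := hS'.zero_mem
    have h1 := (h.symm.mem_iff 0 0).1 h0
    refine ⟨_, h1, ?_⟩
    have hε : ε * ε = 1 := by rcases h.sign with h | h <;> rw [h] <;> norm_num
    constructor
    · linear_combination (-ε * d₁) * h.det - d₁ * hε
    · linear_combination (-ε * d₂) * h.det - d₂ * hε
  obtain ⟨E₁, hE₁, g1, g2⟩ : ∃ u ∈ S, -(2 * s) * u.1 + s * u.2 + d₁ = m ∧
      c * u.1 + e * u.2 + d₂ = m + r' := by
    have h0 := hS'.end_mem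
    have h1 := (h.symm.mem_iff _ _).1 h0
    refine ⟨_, h1, ?_⟩
    have hε : ε * ε = 1 := by rcases h.sign with h | h <;> rw [h] <;> norm_num
    constructor
    · linear_combination (ε * (m - d₁)) * h.det + (m - d₁) * hε
    · linear_combination (ε * (m + r' - d₂)) * h.det + (m + r' - d₂) * hε
  have dz := hdepth _ hS.end_mem
  have rz := hrange _ hS.zero_mem
  simp only [mul_zero, zero_add] at dz rz
  have hdet := h.det
  -- Since y - x ≤ r, some point has y - x ≤ r - m, hence x ≥ m - r and y - 2x ≤ 2(r - m). The width
  -- bound m for y - 2x then gives m ≤ 2r.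
  obtain ⟨u, hu, v, hv, huv⟩ := hS.width (-1) 1 isCoprime_one_right
  have hvr : v.2 - v.1 ≤ r := by
    have h1 := (hS.inTriangle v hv).2.2
    have h2 := (hS.inTriangle v hv).fst_le hS.admissible
    by_contra hlt
    push Not at hlt
    nlinarith
  have hu0 := (hS.inTriangle u hu).1
  rcases hs with rfl | rfl
  · left
    have hE₁' := (hle E₁ hE₁).2 (le_antisymm (hle E₁ hE₁).1 (by linarith))
    have hc : c = -(2 * e) - ε := by linarith
    subst hc
    have hQ := hS.inTriangle E₀ hE₀
    obtain ⟨q, y⟩ := E₀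
    subst hE₁'
    simp only [mul_zero, zero_add] at f1 f2 g1 g2
    obtain ⟨q1, q2, q3⟩ := hQ
    simp only at q1 q2 q3
    subst g1
    have hy : y = 2 * q - d₁ := by linarith
    subst hy
    have hqm : q < d₁ := by
      by_contra hlt
      push Not at hlt
      nlinarith [mul_nonneg (by linarith : 0 ≤ K - 2) (sub_nonneg.2 hlt)]
    have hn : d₁ + r' = ε * q + e * d₁ := by linarith
    have hε : ε = 1 := by
      rcases h.sign with hε | hε
      · exact hε
      · exfalso
        subst hε
        subst g2
        nlinarith
    subst hε
    have hq : r' = q := eq_of_mul_add hr' hrm' (by linarith) (by linarith) (t := e - 1)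
      (by linarith)
    subst hq
    have := (hrange u hu).1
    exact ⟨rfl, rfl, by linarith, by linarith, by linarith⟩
  · right
    have hE₀' := (hle E₀ hE₀).2 (le_antisymm (hle E₀ hE₀).1 (by linarith))
    have hc : c = -(2 * e) + ε := by linarith
    subst hc
    have hQ := hS.inTriangle E₁ hE₁
    obtain ⟨q, y⟩ := E₁
    subst hE₀'
    simp only [mul_zero, zero_add] at f1 f2 g1 g2
    obtain ⟨q1, q2, q3⟩ := hQ
    simp only at q1 q2 q3
    subst f1 f2
    have hy : y = 2 * q - m := by linarith
    subst hy
    have hqm : q < m := by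
      by_contra hlt
      push Not at hlt
      nlinarith [mul_nonneg (by linarith : 0 ≤ K - 2) (sub_nonneg.2 hlt)]
    have hn : m + r' = ε * q - e * m := by linarith
    have hε : ε = -1 := by
      rcases h.sign with hε | hε
      · exfalso
        subst hε
        rw [hn] at dz
        nlinarith
      · exact hε
    subst hε
    have hq : r' = m - q := eq_of_mul_add hr' hrm' (by linarith) (by linarith) (t := -e - 2)
      (by linarith)
    have := (hrange u hu).2
    exact ⟨rfl, rfl, by linarith, by linarith⟩

/-- All possibilities for a lattice isomorphism between supports of negative curves. -/
theorem IsLatticeIso.cases (h : IsLatticeIso S S' a b c e d₁ d₂ ε)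
    (hS : IsNegativeSupport S m r K) (hS' : IsNegativeSupport S' m r' K') :
    (b = 0 ∧ (r' = r ∨ r' = m - r) ∧ ∀ u ∈ S, ∃ u' ∈ S', (u'.1 = u.1 ∨ u'.1 = m - u.1) ∧
      (m + r') * u'.1 - m * u'.2 = (m + r) * u.1 - m * u.2) ∨
    (b = 1 ∧ ε = -1 ∧ r' ≤ r) ∨
    (b = -1 ∧ ε = 1 ∧ m ≤ r + r' ∧ m ≤ (K - 1) * (m - r') ∧ r ≤ (K - 2) * (m - r)) ∨
    (b = 1 ∧ ε = 1 ∧ m ≤ 2 * r ∧ m ≤ 2 * r' ∧ r ≤ (K - 2) * (m - r')) ∨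
    (b = -1 ∧ ε = -1 ∧ m ≤ 2 * r ∧ 2 * r' ≤ m) := by
  have hm := hS.two_le
  have hr := hS.r_pos
  have hrm := hS.r_lt
  have z := (h.mem_iff _ _).1 hS.zero_mem
  have w := (h.mem_iff _ _).1 hS.end_mem
  have z0 := (hS'.inTriangle _ z).fst_nonneg hS'.admissible
  have zm := (hS'.inTriangle _ z).fst_le hS'.admissible
  have w0 := (hS'.inTriangle _ w).fst_nonneg hS'.admissible
  have wm := (hS'.inTriangle _ w).fst_le hS'.admissible
  simp only [mul_zero, zero_add] at z0 zm w0 wm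
  rcases h.abs_le_one hS hS' with rfl | rfl | rfl
  · exact Or.inl ⟨rfl, h.vertical hS hS'⟩
  -- The images of the end vertices differ horizontally by am + (m + r), which has to lie between -m
  -- and m.
  · have ha : a = -1 ∨ a = -(2 * 1) := by
      have h1 : -3 < a := by by_contra hlt; push Not at hlt; nlinarith
      have h2 : a < 0 := by by_contra hlt; push Not at hlt; nlinarith
      omega
    rcases ha with rfl | rfl
    · rcases h.slanted_one (Or.inl rfl) hS hS' with t | t
      · exact Or.inr (Or.inl t)
      · exact Or.inr (Or.inr (Or.inl t))
    · rcases h.slanted_two (Or.inl rfl) hS hS' with t | t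
      · exact Or.inr (Or.inr (Or.inr (Or.inl t)))
      · exact Or.inr (Or.inr (Or.inr (Or.inr t)))
  · have ha : a = - -1 ∨ a = -(2 * -1) := by
      have h1 : a < 3 := by by_contra hlt; push Not at hlt; nlinarith
      have h2 : 0 < a := by by_contra hlt; push Not at hlt; nlinarith
      omega
    rcases ha with rfl | rfl
    · rcases h.slanted_one (Or.inr rfl) hS hS' with t | t
      · exact Or.inr (Or.inl t)
      · exact Or.inr (Or.inr (Or.inl t))
    · rcases h.slanted_two (Or.inr rfl) hS hS' with t | t
      · exact Or.inr (Or.inr (Or.inr (Or.inl t)))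
      · exact Or.inr (Or.inr (Or.inr (Or.inr t)))

/-- The slopes that exceed `3 / 2` among the triangles `IT` and `RT`. -/
def HasSteepBound (m r K : ℤ) : Prop :=
  m ≤ 2 * r → (m = 2 ∧ r = 1) ∨ (K = 4 ∧ r = m - 1 ∧ 3 ≤ m) ∨ (K = 4 ∧ r = m - 2 ∧ 5 ≤ m)

/-- Isomorphic supports have the same slope, or are mirror images of each other. -/
theorem IsLatticeIso.slope_eq (h : IsLatticeIso S S' a b c e d₁ d₂ ε)
    (hS : IsNegativeSupport S m r K) (hS' : IsNegativeSupport S' m r' K')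
    (hb : HasSteepBound m r K) (hb' : HasSteepBound m r' K') :
    r' = r ∨ (r' = m - r ∧ ∀ u ∈ S, ∃ u' ∈ S', (u'.1 = u.1 ∨ u'.1 = m - u.1) ∧
      (m + r') * u'.1 - m * u'.2 = (m + r) * u.1 - m * u.2) := by
  rcases h.cases hS hS' with ⟨-, h1 | h1, h2⟩ | h1
  · exact Or.inl h1
  · exact Or.inr ⟨h1, h2⟩
  left
  -- The inverse has second coefficient -εb and the same sign ε. The types with ε = -1 are paired
  -- with themselves and their inequalities force r = r'; the two with ε = 1 are exchanged, which
  -- makes both slopes steep.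
  have h2 := h.symm.cases hS' hS
  rcases h1 with ⟨rfl, rfl, h1⟩ | ⟨rfl, rfl, h1, h3, h4⟩ | ⟨rfl, rfl, h1, h3, h4⟩ |
    ⟨rfl, rfl, h1, h3⟩ <;>
  norm_num at h2
  · linarith
  · obtain ⟨k1, k2, k3⟩ := h2
    rcases hb k2 with ⟨k4, k5⟩ | ⟨rfl, k5, k6⟩ | ⟨rfl, k5, k6⟩ <;>
    rcases hb' k1 with ⟨l4, l5⟩ | ⟨rfl, l5, l6⟩ | ⟨rfl, l5, l6⟩ <;> omega
  · obtain ⟨k1, k2, k3⟩ := h2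
    rcases hb h1 with ⟨k4, k5⟩ | ⟨rfl, k5, k6⟩ | ⟨rfl, k5, k6⟩ <;>
    rcases hb' h3 with ⟨l4, l5⟩ | ⟨rfl, l5, l6⟩ | ⟨rfl, l5, l6⟩ <;> omega
  · linarith

end Comparison

/-! ### Solutions with steep slopes -/

section Slopes

variable {M N K : ℕ}

/-- The slope of `IT M N K` is `1 + (N + c) / (M + N)` with `M c = N² - 1`. -/
theorem IsSolution.exists_excess (h : IsSolution M N K) (hNM : N ≤ M) (hN : 0 < N) :
    ∃ c : ℤ, 0 ≤ c ∧ c < M ∧ M * c = (N : ℤ) ^ 2 - 1 ∧ (K : ℤ) * N = M + 2 * N + c := by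
  obtain ⟨-, h2⟩ := h.cast
  have hN' : (1 : ℤ) ≤ N := by exact_mod_cast hN
  have hNM' : (N : ℤ) ≤ M := by exact_mod_cast hNM
  have hc : (M : ℤ) * (K * N - M - 2 * N) = (N : ℤ) ^ 2 - 1 := by linear_combination -h2
  refine ⟨K * N - M - 2 * N, ?_, ?_, hc, by ring⟩
  · by_contra hlt
    push Not at hlt
    nlinarith
  · by_contra hlt
    push Not at hlt
    nlinarith

/-- Apart from M = N = 1, one has 0 < c < N < M, and steepness means M ≤ N + 2c. Then KN = M + 2N +
c lies strictly between 3N and 6N. K = 4 turns the equation into (M - N)² = 1, and K = 5 contradicts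
Mc = N² - 1. -/
theorem IsSolution.hasSteepBound_IT (h : IsSolution M N K) (hNM : N ≤ M) (hN : 0 < N) :
    HasSteepBound ((M + N : ℕ) : ℤ) (K * N - (M + N : ℕ)) K := by
  intro hsteep
  obtain ⟨c, hc0, hcM, hc, hKN⟩ := h.exists_excess hNM hN
  obtain ⟨h1, h2⟩ := h.cast
  push_cast at hsteep ⊢
  have hN' : (1 : ℤ) ≤ N := by exact_mod_cast hN
  have hNM' : (N : ℤ) ≤ M := by exact_mod_cast hNM
  generalize (M : ℤ) = x at *
  generalize (N : ℤ) = y at *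
  generalize (K : ℤ) = z at *
  have hx : x ≤ y + 2 * c := by linarith
  rcases eq_or_lt_of_le hN' with rfl | hy
  · left
    have : c = 0 := by nlinarith
    constructor <;> linarith
  · right; right
    have hxy : y < x := by
      rcases eq_or_lt_of_le hNM' with rfl | hlt
      · exfalso
        have hdvd : y ∣ 1 := ⟨y - c, by linear_combination hc⟩
        have := Int.le_of_dvd one_pos hdvd
        linarith
      · exact hlt
    have hcpos : 0 < c := by nlinarith
    have hcy : c < y := by by_contra hlt; push Not at hlt; nlinarith
    have hz1 : z < 6 := by by_contra hlt; push Not at hlt; nlinarith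
    have hz2 : 3 < z := by by_contra hlt; push Not at hlt; nlinarith
    obtain rfl | rfl : z = 4 ∨ z = 5 := by omega
    · have hxy1 : x = y + 1 := by nlinarith
      exact ⟨rfl, by linarith, by linarith⟩
    · exfalso
      have : x = 3 * y - c := by linarith
      subst this
      nlinarith

/-- KN = M + 2N + c with N < M ≤ 2N and 0 < c < N leaves only K = 4, where (M - N)² = 1. -/
theorem IsSolution.eq_four_of_le_two_mul (h : IsSolution M N K) (hNM : N < M) (hN : 1 < N)
    (hsteep : (M : ℤ) ≤ 2 * N) : (K : ℤ) = 4 ∧ (N : ℤ) = M - 1 ∧ (3 : ℤ) ≤ M := by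
  obtain ⟨c, hc0, hcM, hc, hKN⟩ := h.exists_excess hNM.le (by omega)
  obtain ⟨h1, h2⟩ := h.cast
  have hN' : (1 : ℤ) < N := by exact_mod_cast hN
  have hNM' : (N : ℤ) < M := by exact_mod_cast hNM
  generalize (M : ℤ) = x at *
  generalize (N : ℤ) = y at *
  generalize (K : ℤ) = z at *
  have hcpos : 0 < c := by nlinarith
  have hcy : c < y := by by_contra hlt; push Not at hlt; nlinarith
  have hz1 : z < 5 := by by_contra hlt; push Not at hlt; nlinarith
  have hz2 : 3 < z := by by_contra hlt; push Not at hlt; nlinarith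
  obtain rfl : z = 4 := by omega
  have hxy1 : x = y + 1 := by nlinarith
  exact ⟨rfl, by linarith, by linarith⟩

theorem IsSolution.hasSteepBound_RT (h : IsSolution M N K) (hNM : N < M) (hN : 1 < N) :
    HasSteepBound M N K :=
  fun hsteep => Or.inr (Or.inl (h.eq_four_of_le_two_mul hNM hN hsteep))

end Slopes

/-! ### Non-isomorphism of the curves -/

section Curves

theorem IsomorphicCurves.exists_isLatticeIso {f g : LaurentRing k} (h : IsomorphicCurves f g) :
    ∃ a b c e d₁ d₂ ε : ℤ, IsLatticeIso (f.coeff.support : Set (ℤ × ℤ))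
      (g.coeff.support : Set (ℤ × ℤ)) a b c e d₁ d₂ ε := by
  obtain ⟨a, b, c, e, d₁, d₂, hdet, hmem⟩ := h.exists_affine
  exact ⟨a, b, c, e, d₁, d₂, a * e - b * c, hdet, rfl, hmem⟩

theorem IsAdmissible.isCoprime_slope {m r K : ℤ} (h : IsAdmissible m (m + r) K) :
    IsCoprime m r := by
  obtain ⟨s, t, hst⟩ := h.coprime
  exact ⟨s + t, t, by linear_combination hst⟩

/-- For the rational triangle with m = x, r = x - 1, K = 4, depths are at most 2x + 1 in column x -
1 and 2x - 1 in column 1. Both are less than x² - 1, the depth of (x - 1, 0) below an edge of slope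
(x + 1)/x. -/
theorem depth_ne {x u y : ℤ} (hx : 3 ≤ x) (hu : u = x - 1 ∨ u = x - (x - 1)) (hy : 0 ≤ y)
    (hy' : x + (x - 1) + 4 * (u - x) ≤ y) :
    (x + (x - 1)) * u - x * y ≠ (x + 1) * (x - 1) - x * 0 := by
  intro h
  rcases hu with rfl | rfl
  · nlinarith [mul_le_mul_of_nonneg_left hy' (by linarith : 0 ≤ x)]
  · nlinarith [mul_nonneg (by linarith : 0 ≤ x) hy]

variable [CharZero k] {M N K : ℕ} {f : LaurentRing k}

theorem isNegativeSupport {m : ℕ} {r K : ℤ} (hm : 2 ≤ m) (hr : 0 < r) (hrm : r < m) (hK : 3 ≤ K)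
    (hadm : IsAdmissible m (m + r) K) (hirr : Irreducible f) (hf : f ∈ idealE k ^ m)
    (hsupp : ∀ u ∈ f.coeff.support, InTriangle m (m + r) K u) :
    IsNegativeSupport (f.coeff.support : Set (ℤ × ℤ)) m r K := by
  obtain ⟨h0, h1⟩ := mem_support_of_admissible hadm hirr.ne_zero hf hsupp
  exact ⟨by exact_mod_cast hm, hr, hrm, hK, hadm, h0, h1, hsupp,
    fun a b hab => exists_width_ge hm hirr hf hab⟩

theorem SupportsNegativeCurve.isNegativeSupport_IT
    (hf : SupportsNegativeCurve (IT M N K) (M + N) f) (h : IsSolution M N K) (hNM : N ≤ M)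
    (hN : 0 < N) : IsNegativeSupport (f.coeff.support : Set (ℤ × ℤ)) ((M + N : ℕ) : ℤ)
      (K * N - (M + N : ℕ)) K := by
  obtain ⟨-, hpoly, hirr, ⟨hord, -⟩, -⟩ := hf
  obtain ⟨c, hc0, hcM, hc, hKN⟩ := h.exists_excess hNM hN
  have e : ((M + N : ℕ) : ℤ) + (K * N - (M + N : ℕ)) = K * N := by ring
  refine isNegativeSupport (by omega) ?_ ?_ h.cast.1 ?_ hirr hord ?_
  · push_cast; linarith [(by exact_mod_cast hN : (0 : ℤ) < N)]
  · push_cast; linarith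
  · rw [e]; exact h.isAdmissible_IT (by omega) hN
  · rw [e]
    intro u hu
    exact (mem_region_IT_iff h (by omega) hN u).1
      ((newtonPolygon_subset_region_iff _ _).1 hpoly u hu)

theorem SupportsNegativeCurve.isNegativeSupport_RT
    (hf : SupportsNegativeCurve (RT M N K) M f) (h : IsSolution M N K) (hNM : N < M)
    (hN : 1 < N) : IsNegativeSupport (f.coeff.support : Set (ℤ × ℤ)) M N K := by
  obtain ⟨-, hpoly, hirr, ⟨hord, -⟩, -⟩ := hf
  refine isNegativeSupport (by omega) (by omega) (by omega) h.cast.1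
    (h.isAdmissible_RT (by omega)) hirr hord ?_
  intro u hu
  exact (mem_region_RT_iff h (by omega) u).1
    ((newtonPolygon_subset_region_iff _ _).1 hpoly u hu)

variable {M' N' K' : ℕ} {g : LaurentRing k}

theorem not_isomorphicCurves_IT (h : IsSolution M N K) (hNM : N ≤ M) (hN : 0 < N)
    (h' : IsSolution M' N' K') (hNM' : N' ≤ M') (hN' : 0 < N') (hne : (M, N) ≠ (M', N'))
    (hf : SupportsNegativeCurve (IT M N K) (M + N) f)
    (hg : SupportsNegativeCurve (IT M' N' K') (M' + N') g) : ¬ IsomorphicCurves f g := by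
  intro hfg
  obtain ⟨a, b, c, e, d₁, d₂, ε, hiso⟩ := hfg.exists_isLatticeIso
  have hS := hf.isNegativeSupport_IT h hNM hN
  have hS' := hg.isNegativeSupport_IT h' hNM' hN'
  have hb := h.hasSteepBound_IT hNM hN
  have hb' := h'.hasSteepBound_IT hNM' hN'
  have hm := hiso.order_eq hS hS'
  rw [← hm] at hS' hb'
  have hcop := hS.admissible.isCoprime_slope
  have hn : (0 : ℤ) < K * N := by
    have := h.cast.1
    have : (0 : ℤ) < N := by exact_mod_cast hN
    positivity
  obtain ⟨-, h2⟩ := h.cast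
  obtain ⟨-, h2'⟩ := h'.cast
  have hM1 : (N : ℤ) ≤ M := by exact_mod_cast hNM
  have hM1' : (N' : ℤ) ≤ M' := by exact_mod_cast hNM'
  have hN1 : (0 : ℤ) < N := by exact_mod_cast hN
  have hN1' : (0 : ℤ) < N' := by exact_mod_cast hN'
  suffices hMM : (M : ℤ) = M' by
    apply hne
    push_cast at hm
    have : (N : ℤ) = N' := by linarith
    rw [Prod.mk.injEq]
    exact ⟨by exact_mod_cast hMM, by exact_mod_cast this⟩
  push_cast at hm
  -- As M · KN = m² - 1, equal slopes give equal M. For mirror slopes K'N' = 3m - KN, so m divides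
  -- r(M + M') and hence M + M'. Both M and M' lie in [m/2, m), so M + M' = m and M = M'.
  rcases hiso.slope_eq hS hS' hb hb' with hr | ⟨hr, -⟩
  · have e1 : (K : ℤ) * N = K' * N' := by linarith
    apply mul_left_cancel₀ hn.ne'
    rw [← hm] at h2'
    linear_combination h2' - h2 - M' * e1
  · have hdvd : ((M + N : ℕ) : ℤ) ∣ (K * N - (M + N : ℕ)) * (M + M') := by
      refine ⟨-M + 2 * M', ?_⟩
      push_cast at hr ⊢
      rw [← hm] at h2'
      linear_combination h2' - h2 + M' * hr
    obtain ⟨t, ht⟩ := hcop.dvd_of_dvd_mul_left hdvd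
    push_cast at ht
    have ht1 : t < 2 := by by_contra hlt; push Not at hlt; nlinarith
    have ht2 : 0 < t := by by_contra hlt; push Not at hlt; nlinarith
    obtain rfl : t = 1 := by omega
    linarith

theorem not_isomorphicCurves_RT (h : IsSolution M N K) (hNM : N < M) (hN : 1 < N)
    (h' : IsSolution M' N' K') (hNM' : N' < M') (hN' : 1 < N') (hne : (M, N) ≠ (M', N'))
    (hf : SupportsNegativeCurve (RT M N K) M f)
    (hg : SupportsNegativeCurve (RT M' N' K') M' g) : ¬ IsomorphicCurves f g := by
  intro hfg
  obtain ⟨a, b, c, e, d₁, d₂, ε, hiso⟩ := hfg.exists_isLatticeIso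
  have hS := hf.isNegativeSupport_RT h hNM hN
  have hS' := hg.isNegativeSupport_RT h' hNM' hN'
  have hb := h.hasSteepBound_RT hNM hN
  have hb' := h'.hasSteepBound_RT hNM' hN'
  have hm := hiso.order_eq hS hS'
  rw [← hm] at hS' hb'
  rcases hiso.slope_eq hS hS' hb hb' with hr | ⟨hr, -⟩
  · apply hne
    rw [Prod.mk.injEq]
    exact ⟨by exact_mod_cast hm, by exact_mod_cast hr.symm⟩
  -- One of N and N' = m - N is at least m/2, hence equal to m - 1; the other is then 1, which is
  -- excluded.
  · have hst := h.eq_four_of_le_two_mul hNM hN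
    have hst' := h'.eq_four_of_le_two_mul hNM' hN'
    omega

theorem not_isomorphicCurves_IT_RT (h : IsSolution M N K) (hNM : N ≤ M) (hN : 0 < N)
    (h' : IsSolution M' N' K') (hNM' : N' < M') (hN' : 1 < N')
    (hf : SupportsNegativeCurve (IT M N K) (M + N) f)
    (hg : SupportsNegativeCurve (RT M' N' K') M' g) : ¬ IsomorphicCurves f g := by
  intro hfg
  obtain ⟨a, b, c, e, d₁, d₂, ε, hiso⟩ := hfg.exists_isLatticeIso
  have hS := hf.isNegativeSupport_IT h hNM hN
  have hS' := hg.isNegativeSupport_RT h' hNM' hN'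
  have hb := h.hasSteepBound_IT hNM hN
  have hb' := h'.hasSteepBound_RT hNM' hN'
  have hm := hiso.order_eq hS hS'
  rw [← hm] at hS' hb'
  have hcop := hS.admissible.isCoprime_slope
  obtain ⟨δ, hδ0, hδM, hδ, hKN⟩ := h.exists_excess hNM hN
  obtain ⟨-, h2⟩ := h.cast
  obtain ⟨-, h2'⟩ := h'.cast
  have hM1 : (N : ℤ) ≤ M := by exact_mod_cast hNM
  have hN1 : (0 : ℤ) < N := by exact_mod_cast hN
  have hN1' : (1 : ℤ) < N' := by exact_mod_cast hN'
  have hNM1' : (N' : ℤ) < M' := by exact_mod_cast hNM'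
  have hiso' := hiso.slope_eq hS hS' hb hb'
  set r : ℤ := K * N - (M + N : ℕ) with hr
  have hrδ : r = N + δ := by rw [hr]; push_cast; linarith
  push_cast at hm
  -- Modulo m, the rational equation gives r² ≡ 1 and the integral one gives rN ≡ 1. As r = N + δ is
  -- prime to m, m divides δ < M, so δ = 0 and N = r = 1.
  have hsq : ((M + N : ℕ) : ℤ) ∣ r ^ 2 - 1 := by
    push_cast
    rw [hm]
    rcases hiso' with hr' | ⟨hr', -⟩
    · exact ⟨K' * N' - M' - 2 * N', by rw [← hr']; linear_combination h2'⟩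
    · push_cast at hr'
      have : r = M' - N' := by linarith
      exact ⟨K' * N' - 4 * N', by rw [this]; linear_combination h2'⟩
  have hlin : ((M + N : ℕ) : ℤ) ∣ r * N - 1 := by
    refine ⟨K * N - M - 2 * N, ?_⟩
    rw [hr]
    push_cast
    linear_combination h2
  have hδ1 : δ = 0 := by
    have hdvd : ((M + N : ℕ) : ℤ) ∣ r * δ := by
      have := dvd_sub hsq hlin
      have e1 : r ^ 2 - 1 - (r * N - 1) = r * δ := by rw [hrδ]; ring
      rwa [e1] at this
    have h3 := hcop.dvd_of_dvd_mul_left hdvd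
    by_contra h0
    have h4 := Int.le_of_dvd (by omega) h3
    push_cast at h4
    linarith
  have hN2 : (N : ℤ) = 1 := by
    rw [hδ1] at hδ
    nlinarith
  have hr1 : r = 1 := by linarith
  rcases hiso' with hr' | ⟨hr', hpts⟩
  · linarith
  · have hK : (K : ℤ) = M + 2 := by
      rw [hN2, hδ1] at hKN
      linarith
    have hMM : (M : ℤ) = M' - 1 := by linarith
    push_cast at hr'
    have hNN' : (N' : ℤ) = M' - 1 := by linarith
    -- On this triangle x - y ≥ -1, so width m = M + 1 in direction (1,-1) needs a point with x - y
    -- ≥ M, and (M,0) is the only one.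
    have hmem : ((M : ℤ), (0 : ℤ)) ∈ (f.coeff.support : Set (ℤ × ℤ)) := by
      obtain ⟨u, hu, v, hv, huv⟩ := hS.width 1 (-1) isCoprime_one_left
      have hu1 := (hS.inTriangle u hu).2.2
      have hu2 := (hS.inTriangle u hu).fst_le hS.admissible
      obtain ⟨hv1, hv2, -⟩ := hS.inTriangle v hv
      have hv4 := (hS.inTriangle v hv).fst_le hS.admissible
      rw [hr1] at hu1 hv2
      rw [hK] at hv2
      push_cast at hu1 hu2 hv2 hv4 huv
      rw [hN2] at hu1 hu2 hv2 hv4 huv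
      have hu3 : -1 ≤ u.1 - u.2 := by
        by_contra hlt
        push Not at hlt
        nlinarith
      have hv5 : v.1 = M := by
        have h5 : (M : ℤ) ≤ v.1 := by linarith
        by_contra hne
        have h6 : v.1 = M + 1 := by omega
        rw [h6] at hv2 huv
        nlinarith
      have hv6 : v.2 = 0 := by linarith
      have : v = ((M : ℤ), (0 : ℤ)) := Prod.ext hv5 hv6
      rwa [this] at hv
    obtain ⟨u', hu', hx, hdepth⟩ := hpts _ hmem
    have hK' : (K' : ℤ) = 4 := by
      rw [hNN'] at h2'
      have hpos : (0 : ℤ) < M' * (M' - 1) := mul_pos (by linarith) (by linarith)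
      apply mul_left_cancel₀ hpos.ne'
      linear_combination -h2'
    obtain ⟨hy1, hy2, -⟩ := hS'.inTriangle u' hu'
    push_cast at hdepth hx hy2
    rw [hm] at hdepth hx hy2
    rw [hr1, hNN', hMM] at hdepth
    rw [hMM] at hx
    rw [hK', hNN'] at hy2
    exact depth_ne (by linarith) hx hy1 hy2 hdepth

end Curves

end NegativeCurves

theorem theorem1p1 {k : Type*} [Field k] [IsAlgClosed k] [CharZero k] :
    -- each integral triangle, and each rational triangle with `M > 0`, supports a negative curve
    (∀ M N K : ℕ, NegativeCurves.IsSolution M N K →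
      (∃ f : NegativeCurves.LaurentRing k,
        NegativeCurves.SupportsNegativeCurve (NegativeCurves.IT M N K) (M + N) f) ∧
      (0 < M → ∃ f : NegativeCurves.LaurentRing k,
        NegativeCurves.SupportsNegativeCurve (NegativeCurves.RT M N K) M f)) ∧
    -- the curves of two different integral triangles are not isomorphic
    (∀ M N K M' N' K' : ℕ,
      NegativeCurves.IsSolution M N K → N ≤ M → 0 < N →
      NegativeCurves.IsSolution M' N' K' → N' ≤ M' → 0 < N' →
      (M, N) ≠ (M', N') →
      ∀ f g : NegativeCurves.LaurentRing k,
        NegativeCurves.SupportsNegativeCurve (NegativeCurves.IT M N K) (M + N) f →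
        NegativeCurves.SupportsNegativeCurve (NegativeCurves.IT M' N' K') (M' + N') g →
        ¬ NegativeCurves.IsomorphicCurves f g) ∧
    -- the curves of two different rational triangles are not isomorphic
    (∀ M N K M' N' K' : ℕ,
      NegativeCurves.IsSolution M N K → N < M → 1 < N →
      NegativeCurves.IsSolution M' N' K' → N' < M' → 1 < N' →
      (M, N) ≠ (M', N') →
      ∀ f g : NegativeCurves.LaurentRing k,
        NegativeCurves.SupportsNegativeCurve (NegativeCurves.RT M N K) M f →
        NegativeCurves.SupportsNegativeCurve (NegativeCurves.RT M' N' K') M' g →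
        ¬ NegativeCurves.IsomorphicCurves f g) ∧
    -- the curves of an integral and of a rational triangle are not isomorphic
    (∀ M N K M' N' K' : ℕ,
      NegativeCurves.IsSolution M N K → N ≤ M → 0 < N →
      NegativeCurves.IsSolution M' N' K' → N' < M' → 1 < N' →
      ∀ f g : NegativeCurves.LaurentRing k,
        NegativeCurves.SupportsNegativeCurve (NegativeCurves.IT M N K) (M + N) f →
        NegativeCurves.SupportsNegativeCurve (NegativeCurves.RT M' N' K') M' g →
        ¬ NegativeCurves.IsomorphicCurves f g) := by
  exact ⟨fun M N K h => ⟨NegativeCurves.exists_supportsNegativeCurve_IT h,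
      fun hM => NegativeCurves.exists_supportsNegativeCurve_RT h hM⟩,
    fun M N K M' N' K' h hNM hN h' hNM' hN' hne f g hf hg =>
      NegativeCurves.not_isomorphicCurves_IT h hNM hN h' hNM' hN' hne hf hg,
    fun M N K M' N' K' h hNM hN h' hNM' hN' hne f g hf hg =>
      NegativeCurves.not_isomorphicCurves_RT h hNM hN h' hNM' hN' hne hf hg,
    fun M N K M' N' K' h hNM hN h' hNM' hN' f g hf hg =>
      NegativeCurves.not_isomorphicCurves_IT_RT h hNM hN h' hNM' hN' hf hg⟩
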